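/- For a field $k$ of characteristic $0$, the degree of a rational function $\phi=p/q\in k(x)$ (with $p,q$ coprime) is $\max\{\deg p,\deg q\}$, and $\operatorname{Rat}_d(k)$ denotes the set of rational functions of degree $d\ge 1$ over $k$. A map $\phi\in\operatorname{Rat}_d(k)$ is viewed as a morphism $\mathbb{P}^1\to\mathbb{P}^1$; a critical point of $\phi$ is a point of $\mathbb{P}^1(\bar k)$ at which $\phi$ is ramified, and a point is $n$-periodic for $\phi$ if $n$ is the least positive integer with $\phi^n(P)=P$ (where $\phi^n$ is the $n$-th iterate). For $\phi\in\mathbb{Q}(x)$ nonconstant, let $\langle\phi\rangle=\{\sigma^{-1}\circ\phi\circ\sigma:\sigma\in\operatorname{Rat}_1(\mathbb{Q})\}$ be its linear conjugacy class over $\mathbb{Q}$, and let \[\langle C_4\rangle=\{\langle\phi\rangle:\phi\in\operatorname{Rat}_2(\mathbb{Q})\text{ has a $4$-periodic critical point in }\mathbb{P}^1(\overline{\mathbb{Q}})\}.\] Proposition. For $c\in\mathbb{Q}\setminus\{0,\pm1\}$ define $\phi_c\in\mathbb{Q}(x)$ by \[\phi_c=\frac{(c+c^2-c^3)x-c^2}{(c^3-c^2-c+1)x^2-(c^3-c^2-c)x-c^2}.\]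 Then $\langle C_4\rangle=\{\langle\phi_c\rangle:c\in\mathbb{Q}\setminus\{0,\pm1\}\}$. Moreover, every map $\phi_c$ with $c\in\mathbb{Q}\setminus\{0,\pm1\}$ has exactly one $4$-periodic critical point in $\mathbb{P}^1(\overline{\mathbb{Q}})$, namely $0$. -/

import Mathlib

noncomputable section

namespace RatDyn

open Polynomial

/-- The degree of a rational function `φ = p / q` in lowest terms: `max (deg p) (deg q)`. -/
def degree {K : Type*} [Field K] (φ : RatFunc K) : ℕ :=
  max φ.num.natDegree φ.denom.natDegree

/-- `Rat_d(K)`: the rational functions of degree `d` with coefficients in `K` (used for `d ≥ 1`). -/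
def Rat (d : ℕ) (K : Type*) [Field K] : Set (RatFunc K) :=
  {φ | degree φ = d}

/-- The composition `φ ∘ ψ = φ(ψ(x))` of rational functions (used for nonconstant `ψ`, where the
denominator of `φ` does not vanish at `ψ`). -/
def comp {K : Type*} [Field K] (φ ψ : RatFunc K) : RatFunc K :=
  φ.eval (RatFunc.C : K →+* RatFunc K) ψ

/-- Linear conjugacy over `K`: there is `σ ∈ Rat_1(K)`, with compositional inverse `τ`, such that
`ψ = σ⁻¹ ∘ φ ∘ σ`. -/
def LinearlyConjugate {K : Type*} [Field K] (φ ψ : RatFunc K) : Prop :=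
  ∃ σ ∈ Rat 1 K, ∃ τ ∈ Rat 1 K,
    comp σ τ = RatFunc.X ∧ comp τ σ = RatFunc.X ∧ ψ = comp τ (comp φ σ)

/-- The conjugacy class `⟨φ⟩` over `K` (the arithmetic dynamical system of `φ`). -/
def arithClass {K : Type*} [Field K] (φ : RatFunc K) : Set (RatFunc K) :=
  {ψ | LinearlyConjugate φ ψ}

open Classical in
/-- The self-map of `ℙ¹(L) = L ∪ {∞}` induced by `φ = p / q ∈ K(x)`, for a field extension `L / K`.
In homogeneous coordinates, with `d = deg φ`, it is `[x : y] ↦ [y ^ d p(x / y) : y ^ d q(x / y)]`;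
the image of `∞ = [1 : 0]` is given by the coefficients of `x ^ d` in `p` and `q`. -/
def toMap {K : Type*} [Field K] (L : Type*) [Field L] [Algebra K L] (φ : RatFunc K) :
    OnePoint L → OnePoint L
  | none =>
      if φ.denom.coeff (degree φ) = 0 then OnePoint.infty
      else ((algebraMap K L (φ.num.coeff (degree φ) / φ.denom.coeff (degree φ)) : L) : OnePoint L)
  | some x =>
      if aeval x φ.denom = 0 then OnePoint.infty
      else ((aeval x φ.num / aeval x φ.denom : L) : OnePoint L)

/-- The (dehomogenized) form of degree `deg φ` that cuts out the fibre of `φ = p / q` over a point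
of `ℙ¹(L)`: it is `p - y q` over `y ∈ L` and `q` over `∞`. -/
def fibrePoly {K : Type*} [Field K] {L : Type*} [Field L] [Algebra K L] (φ : RatFunc K) :
    OnePoint L → L[X]
  | none => φ.denom.map (algebraMap K L)
  | some y => φ.num.map (algebraMap K L) - C y * φ.denom.map (algebraMap K L)

/-- The ramification index of `φ` at a point `P` of `ℙ¹(L)`: the order of vanishing at `P` of the
form of degree `deg φ` that cuts out the fibre of `φ` over `φ(P)`. -/
def ramificationIndex {K : Type*} [Field K] {L : Type*} [Field L] [Algebra K L] (φ : RatFunc K) :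
    OnePoint L → ℕ
  | none => degree φ - (fibrePoly φ (toMap L φ OnePoint.infty)).natDegree
  | some x => (fibrePoly φ (toMap L φ (x : OnePoint L))).rootMultiplicity x

/-- A critical point of `φ` is a point at which `φ` is ramified. -/
def IsCriticalPt {K : Type*} [Field K] {L : Type*} [Field L] [Algebra K L] (φ : RatFunc K)
    (P : OnePoint L) : Prop :=
  1 < ramificationIndex φ P

/-- A point is `n`-periodic (`n ≥ 1`) if its least positive period is `n`. -/
def IsNPeriodicPt {K : Type*} [Field K] {L : Type*} [Field L] [Algebra K L] (n : ℕ)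
    (φ : RatFunc K) (P : OnePoint L) : Prop :=
  0 < n ∧ Function.minimalPeriod (toMap L φ) P = n

/-- The set of `n`-periodic critical points of `φ ∈ ℚ(x)` in `ℙ¹(ℚ̄)`. -/
def periodicCriticalPts (n : ℕ) (φ : RatFunc ℚ) : Set (OnePoint (AlgebraicClosure ℚ)) :=
  {P | IsCriticalPt φ P ∧ IsNPeriodicPt n φ P}

/-- `⟨C_n⟩`: the arithmetic dynamical systems `⟨φ⟩` of maps `φ ∈ Rat_2(ℚ)` that have an
`n`-periodic critical point in `ℙ¹(ℚ̄)`. -/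
def arithC (n : ℕ) : Set (Set (RatFunc ℚ)) :=
  {S | ∃ φ ∈ Rat 2 ℚ, (periodicCriticalPts n φ).Nonempty ∧ S = arithClass φ}

/-- The family `φ_c`. -/
def phi (c : ℚ) : RatFunc ℚ :=
  (RatFunc.C (c + c ^ 2 - c ^ 3) * RatFunc.X - RatFunc.C (c ^ 2)) /
    (RatFunc.C (c ^ 3 - c ^ 2 - c + 1) * RatFunc.X ^ 2
      - RatFunc.C (c ^ 3 - c ^ 2 - c) * RatFunc.X - RatFunc.C (c ^ 2))

end RatDyn

end

noncomputable section

namespace RatDyn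

open Polynomial

/-! Let P be a critical point of exact period 4 of a quadratic map F. The four points of its cycle
are distinct. Take the coordinate in which P = ∞, F³P = 0 and FP − F²P = 1, and let c be the
coordinate of F²P. The cycle is then ∞ → c+1 → c → 0 → ∞. Together with ramification at ∞ this
determines F, and it forces c ≠ 0, ±1 (`exists_isNormalForm`). When P is rational, so are the
coordinate and c, and `phi c` is the same map in yet another rational coordinate, where the cycle
reads 0 → 1 → c → c/(1+c−c²) → 0 (`linearlyConjugate_phi`).

Two things remain: `phi c` has no further 4-periodic critical point, and a map over ℚ with a
4-periodic critical point over the algebraic closure has a rational one. Both depend on the other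
critical point of the normal form, (1+c−c²)/(2(1−c)). Following it for four steps shows that, if it
has exact period 4, then c is a root of 1+c−c², c²+c−1, c²−c+1 or a polynomial of degree 20
(`parameter_eq_zero`). The three quadratics are the cases where it lies on the first cycle, at 0,
c+1 and c respectively. The polynomial of degree 20 has no root in a number field of degree at most
2 (`secondCritPoly_ne_zero`, by reduction modulo 3). For rational c none of the four vanishes, which
gives uniqueness (`periodicCriticalPts_phi`).

For rationality (`exists_rational_isCritFour`), a finite P is a root of a Wronskian of degree at
most 2, so it lives in a field K of degree at most 2. If σ in Gal(K/ℚ) moves P, then σP is the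
second critical point and is again 4-periodic, so it lies on the cycle of P. As σ commutes with F
and σ²P = P, the cases σP = FP and σP = F³P would give F²P = P. If σP = F²P, then c² − c + 1 = 0.
But c is a cross-ratio of the cycle that does not change when the cycle is shifted by two, so c is
Galois-invariant, hence rational, which is absurd (`IsCritFour.mapPt_eq`). -/

/-- The determinant of two vectors in the plane. -/
def det₂ {L : Type*} [Field L] (z w : L × L) : L := z.1 * w.2 - z.2 * w.1

open Classical in
/-- The point of `ℙ¹(L)` with given homogeneous coordinates. -/
def proj {L : Type*} [Field L] (z : L × L) : OnePoint L :=
  if z.2 = 0 then OnePoint.infty else ((z.1 / z.2 : L) : OnePoint L)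

/-- Normalized homogeneous coordinates of a point of `ℙ¹(L)`. -/
def lift {L : Type*} [Field L] : OnePoint L → L × L
  | none => (1, 0)
  | some x => (x, 1)

/-! ### Homogeneous coordinates on the projective line -/

section Plane

variable {L : Type*} [Field L]

lemma proj_lift (P : OnePoint L) : proj (lift P) = P := by
  cases P with
  | infty => exact if_pos rfl
  | coe x =>
    change proj (x, 1) = _
    simp [proj]

lemma lift_ne_zero (P : OnePoint L) : lift P ≠ 0 := by
  cases P with
  | infty => exact fun h => one_ne_zero (congrArg Prod.fst h)
  | coe x => exact fun h => one_ne_zero (congrArg Prod.snd h)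

lemma ne_zero_of_det₂_left {z w : L × L} (h : det₂ z w ≠ 0) : z ≠ 0 := by
  rintro rfl; simp [det₂] at h

lemma ne_zero_of_det₂_right {z w : L × L} (h : det₂ z w ≠ 0) : w ≠ 0 := by
  rintro rfl; simp [det₂] at h

lemma det₂_eq_zero_iff {z w : L × L} (hz : z ≠ 0) (hw : w ≠ 0) :
    det₂ z w = 0 ↔ ∃ k : L, k ≠ 0 ∧ z = k • w := by
  obtain ⟨a, b⟩ := z
  obtain ⟨c, d⟩ := w
  constructor
  · intro h
    simp only [det₂] at h
    by_cases hd : d = 0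
    · have hc : c ≠ 0 := fun hc => hw (by simp [hc, hd])
      have hb : b = 0 := by
        subst hd
        have : b * c = 0 := by linear_combination -h
        exact (mul_eq_zero.1 this).resolve_right hc
      have ha : a ≠ 0 := fun ha => hz (by simp [ha, hb])
      exact ⟨a / c, div_ne_zero ha hc, by ext <;> simp [hd, hb, hc]⟩
    · have hb : b ≠ 0 := by
        rintro rfl
        have : a * d = 0 := by linear_combination h
        exact hz (by simp [(mul_eq_zero.1 this).resolve_right hd])
      refine ⟨b / d, div_ne_zero hb hd, ?_⟩
      ext
      · simp only [Prod.smul_mk, smul_eq_mul]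
        field_simp
        linear_combination h
      · simp [hd]
  · rintro ⟨k, -, h⟩
    simp only [Prod.smul_mk, Prod.mk.injEq, smul_eq_mul] at h
    simp only [det₂, h.1, h.2]
    ring

lemma proj_eq_proj_iff {z w : L × L} (hz : z ≠ 0) (hw : w ≠ 0) :
    proj z = proj w ↔ det₂ z w = 0 := by
  obtain ⟨a, b⟩ := z
  obtain ⟨c, d⟩ := w
  by_cases hb : b = 0 <;> by_cases hd : d = 0
  · simp [proj, det₂, hb, hd]
  · have ha : a ≠ 0 := fun ha => hz (by simp [ha, hb])
    simp [proj, det₂, hb, hd, ha]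
  · have hc : c ≠ 0 := fun ha => hw (by simp [ha, hd])
    simp [proj, det₂, hb, hd, hc]
  · simp only [proj, det₂, hb, hd, if_false, OnePoint.coe_eq_coe]
    rw [div_eq_div_iff hb hd, sub_eq_zero, mul_comm b c]

lemma proj_smul {k : L} (hk : k ≠ 0) {z : L × L} (hz : z ≠ 0) : proj (k • z) = proj z :=
  (proj_eq_proj_iff (smul_ne_zero hk hz) hz).2
    ((det₂_eq_zero_iff (smul_ne_zero hk hz) hz).2 ⟨k, hk, rfl⟩)

lemma det₂_combination (Z W : L × L) (x y x' y' : L) :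
    det₂ (x • Z + y • W) (x' • Z + y' • W) = (x * y' - y * x') * det₂ Z W := by
  simp only [det₂, Prod.fst_add, Prod.snd_add, Prod.smul_fst, Prod.smul_snd, smul_eq_mul]
  ring

lemma combination_ne_zero {Z W : L × L} (h : det₂ Z W ≠ 0) {x y : L} (hxy : x ≠ 0 ∨ y ≠ 0) :
    x • Z + y • W ≠ 0 := by
  rcases hxy with hx | hy
  · refine ne_zero_of_det₂_left (w := W) ?_
    have := det₂_combination Z W x y 0 1
    rw [zero_smul, one_smul, zero_add] at this
    rw [this]; simpa using ⟨hx, h⟩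
  · refine ne_zero_of_det₂_left (w := Z) ?_
    have := det₂_combination Z W x y 1 0
    rw [zero_smul, one_smul, add_zero] at this
    rw [this]; simpa using ⟨hy, h⟩

lemma exists_combination {Z W : L × L} (h : det₂ Z W ≠ 0) (v : L × L) :
    ∃ x y : L, v = x • Z + y • W := by
  refine ⟨det₂ v W / det₂ Z W, det₂ Z v / det₂ Z W, ?_⟩
  ext <;> simp only [Prod.fst_add, Prod.snd_add, Prod.smul_fst, Prod.smul_snd, smul_eq_mul] <;>
    field_simp <;> simp only [det₂] <;> ring

end Plane

/-! ### Quadratic maps as pairs of binary forms -/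

/-- A pair of binary quadratic forms
`(a x² + b x y + c y², d x² + e x y + f y²)`. -/
structure QuadPair (L : Type*) where
  a : L
  b : L
  c : L
  d : L
  e : L
  f : L

namespace QuadPair

variable {L : Type*} [Field L]

/-- The quadratic self-map of the plane given by a pair of forms. -/
def eval (F : QuadPair L) (z : L × L) : L × L :=
  (F.a * z.1 ^ 2 + F.b * z.1 * z.2 + F.c * z.2 ^ 2,
    F.d * z.1 ^ 2 + F.e * z.1 * z.2 + F.f * z.2 ^ 2)

/-- The symmetric bilinear map attached to a pair of forms. -/
def polar (F : QuadPair L) (z w : L × L) : L × L :=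
  (2 * F.a * z.1 * w.1 + F.b * (z.1 * w.2 + z.2 * w.1) + 2 * F.c * z.2 * w.2,
    2 * F.d * z.1 * w.1 + F.e * (z.1 * w.2 + z.2 * w.1) + 2 * F.f * z.2 * w.2)

/-- The two forms have no common zero. -/
def Nondeg (F : QuadPair L) : Prop := ∀ z, z ≠ 0 → F.eval z ≠ 0

/-- The derivative of the induced map of `ℙ¹` vanishes at `z`. -/
def IsCrit (F : QuadPair L) (z : L × L) : Prop := ∀ w, det₂ (F.polar z w) (F.eval z) = 0

/-- The induced map of `ℙ¹`. -/
def onLine (F : QuadPair L) (P : OnePoint L) : OnePoint L := proj (F.eval (lift P))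

lemma eval_smul (F : QuadPair L) (k : L) (z : L × L) : F.eval (k • z) = k ^ 2 • F.eval z := by
  ext <;> simp [eval] <;> ring

lemma polar_smul (F : QuadPair L) (k : L) (z w : L × L) :
    F.polar (k • z) w = k • F.polar z w := by
  ext <;> simp [polar] <;> ring

lemma eval_combination (F : QuadPair L) (x y : L) (z w : L × L) :
    F.eval (x • z + y • w) = x ^ 2 • F.eval z + (x * y) • F.polar z w + y ^ 2 • F.eval w := by
  ext <;> simp [polar, eval] <;> ring

lemma IsCrit.smul {F : QuadPair L} {z : L × L} (h : F.IsCrit z) (k : L) : F.IsCrit (k • z) := by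
  intro w
  have := h w
  rw [polar_smul, eval_smul]
  simp only [det₂, Prod.smul_fst, Prod.smul_snd, smul_eq_mul] at this ⊢
  linear_combination k ^ 3 * this

/-- Frees the dynamics from the normalized representative `lift`: any nonzero vector over the point
may be used. -/
lemma onLine_proj {F : QuadPair L} (hF : F.Nondeg) {z : L × L} (hz : z ≠ 0) :
    F.onLine (proj z) = proj (F.eval z) := by
  obtain ⟨k, hk, h⟩ := (det₂_eq_zero_iff (lift_ne_zero (proj z)) hz).1
    ((proj_eq_proj_iff (lift_ne_zero _) hz).1 (proj_lift (proj z)))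
  rw [onLine, h, eval_smul, proj_smul (pow_ne_zero 2 hk) (hF z hz)]

end QuadPair

lemma minimalPeriod_eq_four_iff {α : Type*} (f : α → α) (x : α) :
    Function.minimalPeriod f x = 4 ↔ f^[4] x = x ∧ f^[2] x ≠ x := by
  constructor
  · intro h
    refine ⟨h ▸ Function.isPeriodicPt_minimalPeriod f x, fun h2 => ?_⟩
    have := (show Function.IsPeriodicPt f 2 x from h2).minimalPeriod_dvd
    rw [h] at this
    omega
  · rintro ⟨h4, h2⟩
    have hd := (show Function.IsPeriodicPt f 4 x from h4).minimalPeriod_dvd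
    have h2' : ¬ Function.minimalPeriod f x ∣ 2 := fun h =>
      h2 ((Function.isPeriodicPt_iff_minimalPeriod_dvd).2 h)
    have hle := Nat.le_of_dvd (by norm_num) hd
    interval_cases Function.minimalPeriod f x <;> simp_all

/-! ### The normal form and the orbit of its second critical point -/

/-- The normal form of a quadratic map of `ℙ¹` with a `4`-periodic critical point, normalized so
that the critical cycle is `∞ ↦ c + 1 ↦ c ↦ 0 ↦ ∞`. -/
def normalMap {L : Type*} [Field L] (c : L) (z : L × L) : L × L :=
  ((c + 1) * (z.1 * ((1 + c - c ^ 2) * z.2 + (c - 1) * z.1) - c * z.2 ^ 2),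
    z.1 * ((1 + c - c ^ 2) * z.2 + (c - 1) * z.1))

/-- Up to elementary factors, the condition on the parameter for the second critical point of the
normal form to be 4-periodic. -/
def secondCritPoly {R : Type*} [CommRing R] (c : R) : R :=
        2 * c ^ 20 - 8 * c ^ 19 + 7 * c ^ 18 + 22 * c ^ 17 - 76 * c ^ 16 + 108 * c ^ 15 
        - 12 * c ^ 14 - 274 * c ^ 13 + 458 * c ^ 12 - 118 * c ^ 11 - 489 * c ^ 10 + 706 * c ^ 9 
        - 378 * c ^ 8 - 294 * c ^ 7 + 800 * c ^ 6 - 500 * c ^ 5 - 204 * c ^ 4 + 382 * c ^ 3 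
        - 125 * c ^ 2 - 20 * c + 14

/-- A representative of the image of the second critical point of the normal form under iterate
number 1. -/
def critOrbit1 {L : Type*} [Field L] (c : L) : L × L :=
    (-c ^ 5 + c ^ 4 - c ^ 3 - c ^ 2 + c - 1,
      -c ^ 4 + 2 * c ^ 3 + c ^ 2 - 2 * c - 1)

/-- A representative of the image of the second critical point of the normal form under iterate
number 2. -/
def critOrbit2 {L : Type*} [Field L] (c : L) : L × L :=
    (c ^ 9 - 2 * c ^ 7 + 4 * c ^ 6 - 5 * c ^ 5 - 8 * c ^ 4 + 18 * c ^ 3 - 11 * c + 4,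
      c ^ 8 - 6 * c ^ 6 + 12 * c ^ 5 - 9 * c ^ 4 - 4 * c ^ 3 + 14 * c ^ 2 - 12 * c + 5)

/-- A representative of the image of the second critical point of the normal form under iterate
number 3. -/
def critOrbit3 {L : Type*} [Field L] (c : L) : L × L :=
    (4 * c ^ 18 - 8 * c ^ 17 - 4 * c ^ 16 + 32 * c ^ 15 - 80 * c ^ 14 + 88 * c ^ 13 + 72 * c ^ 12 
        - 216 * c ^ 11 + 148 * c ^ 10 - 168 * c ^ 9 + 108 * c ^ 8 + 424 * c ^ 7 - 592 * c ^ 6 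
        - 32 * c ^ 5 + 368 * c ^ 4 - 120 * c ^ 3 - 28 * c ^ 2 + 4,
      5 * c ^ 17 - 12 * c ^ 16 - 4 * c ^ 15 + 48 * c ^ 14 - 86 * c ^ 13 + 40 * c ^ 12 
        + 160 * c ^ 11 - 288 * c ^ 10 + 71 * c ^ 9 + 140 * c ^ 8 - 64 * c ^ 7 + 128 * c ^ 6 
        - 294 * c ^ 5 + 88 * c ^ 4 + 188 * c ^ 3 - 144 * c ^ 2 + 21 * c + 4)

/-- A representative of the image of the second critical point of the normal form under iterate
number 4. -/
def critOrbit4 {L : Type*} [Field L] (c : L) : L × L :=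
    (-4 * c ^ 36 + 28 * c ^ 35 - 57 * c ^ 34 - 52 * c ^ 33 + 428 * c ^ 32 - 704 * c ^ 31 
        - 292 * c ^ 30 + 3616 * c ^ 29 - 5864 * c ^ 28 - 3560 * c ^ 27 + 27974 * c ^ 26 
        - 43000 * c ^ 25 + 8816 * c ^ 24 + 87696 * c ^ 23 - 183280 * c ^ 22 + 133216 * c ^ 21 
        + 124444 * c ^ 20 - 389404 * c ^ 19 + 380709 * c ^ 18 - 39564 * c ^ 17 - 452108 * c ^ 16 
        + 681936 * c ^ 15 - 252272 * c ^ 14 - 493472 * c ^ 13 + 646080 * c ^ 12 - 89304 * c ^ 11 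
        - 342682 * c ^ 10 + 233480 * c ^ 9 + 22600 * c ^ 8 - 88656 * c ^ 7 + 35004 * c ^ 6 
        + 4768 * c ^ 5 - 9980 * c ^ 4 + 3564 * c ^ 3 + 359 * c ^ 2 - 564 * c + 100,
      -4 * c ^ 35 + 32 * c ^ 34 - 64 * c ^ 33 - 108 * c ^ 32 + 640 * c ^ 31 - 768 * c ^ 30 
        - 1520 * c ^ 29 + 7216 * c ^ 28 - 9448 * c ^ 27 - 9408 * c ^ 26 + 54960 * c ^ 25 
        - 87480 * c ^ 24 + 38160 * c ^ 23 + 120384 * c ^ 22 - 305376 * c ^ 21 + 328800 * c ^ 20 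
        - 62076 * c ^ 19 - 385440 * c ^ 18 + 741488 * c ^ 17 - 703268 * c ^ 16 + 54480 * c ^ 15 
        + 867008 * c ^ 14 - 1126368 * c ^ 13 + 393312 * c ^ 12 + 448104 * c ^ 11 - 602560 * c ^ 10 
        + 305136 * c ^ 9 - 50392 * c ^ 8 - 68240 * c ^ 7 + 102208 * c ^ 6 - 68528 * c ^ 5 
        + 20496 * c ^ 4 - 1140 * c ^ 3 + 160 * c ^ 2 - 512 * c + 116)

variable {L : Type*} [Field L]

/-- In this lemma and the next ones the scalar is a common factor of both coordinates, split off to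
keep the degrees of the orbit polynomials small. -/
lemma normalMap_critOrbit0 (c : L) :
    normalMap c (1 + c - c ^ 2, 2 * (1 - c)) = (c - 1) • critOrbit1 c := by
  ext <;> simp only [normalMap, critOrbit1, Prod.smul_mk, smul_eq_mul] <;> ring

lemma normalMap_critOrbit1 (c : L) :
    normalMap c (critOrbit1 c) = (c ^ 2 + c) • critOrbit2 c := by
  ext <;> simp only [normalMap, critOrbit1, critOrbit2, Prod.smul_mk, smul_eq_mul] <;> ring

lemma normalMap_critOrbit2 (c : L) :
    normalMap c (critOrbit2 c) = (1 : L) • critOrbit3 c := by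
  ext <;> simp only [normalMap, critOrbit2, critOrbit3, Prod.smul_mk, smul_eq_mul] <;> ring

lemma normalMap_critOrbit3 (c : L) :
    normalMap c (critOrbit3 c) = (c ^ 2 + c) • critOrbit4 c := by
  ext <;> simp only [normalMap, critOrbit3, critOrbit4, Prod.smul_mk, smul_eq_mul] <;> ring

/-- The condition for period dividing 2 is a factor of the condition for period dividing 4. The
three quadratic factors are the parameters for which the second critical point is 0, c+1 or c, so
that it lies on the first critical cycle. -/
lemma det₂_critOrbit4 (c : L) :
    det₂ (critOrbit4 c) (1 + c - c ^ 2, 2 * (1 - c)) =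
      2 * (c - 1) * (1 + c - c ^ 2) * (c ^ 2 + c - 1) * (c ^ 2 - c + 1) * secondCritPoly c *
        det₂ (critOrbit2 c) (1 + c - c ^ 2, 2 * (1 - c)) := by
  simp only [det₂, critOrbit2, critOrbit4, secondCritPoly]
  ring

lemma combination_injective {Z W : L × L} (h : det₂ Z W ≠ 0) {x y x' y' : L}
    (e : x • Z + y • W = x' • Z + y' • W) : x = x' ∧ y = y' := by
  by_contra hne
  have h0 : (x - x') • Z + (y - y') • W = 0 := by
    rw [sub_smul, sub_smul]
    linear_combination (exp := 1) e
  refine combination_ne_zero h ?_ h0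
  rw [sub_ne_zero, sub_ne_zero]
  tauto

lemma exists_smul_of_det₂_eq_zero {v u : L × L} (hu : u ≠ 0) (h : det₂ v u = 0) :
    ∃ k : L, v = k • u := by
  by_cases hv : v = 0
  · exact ⟨0, by simp [hv]⟩
  · obtain ⟨k, -, hk⟩ := (det₂_eq_zero_iff hv hu).1 h
    exact ⟨k, hk⟩

/-! ### Reduction to the normal form -/

namespace QuadPair

/-- In the basis `Z, W`, the pair `F` is a multiple of the normal form with parameter `c`. -/
structure IsNormalForm (F : QuadPair L) (Z W : L × L) (c ρ : L) : Prop where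
  det_ne : det₂ Z W ≠ 0
  scale_ne : ρ ≠ 0
  ne_zero : c ≠ 0
  ne_one : c ≠ 1
  ne_neg_one : c ≠ -1
  eval_eq : ∀ x y : L, F.eval (x • Z + y • W) =
    ρ • ((normalMap c (x, y)).1 • Z + (normalMap c (x, y)).2 • W)

lemma eval_lift {F : QuadPair L} (hF : F.Nondeg) (P : OnePoint L) :
    ∃ k : L, k ≠ 0 ∧ F.eval (lift P) = k • lift (F.onLine P) :=
  (det₂_eq_zero_iff (hF _ (lift_ne_zero P)) (lift_ne_zero _)).1
    ((proj_eq_proj_iff (hF _ (lift_ne_zero P)) (lift_ne_zero _)).1 (proj_lift _).symm)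

lemma det₂_lift_ne_zero {P Q : OnePoint L} (h : P ≠ Q) : det₂ (lift P) (lift Q) ≠ 0 := by
  intro h0
  rw [← proj_eq_proj_iff (lift_ne_zero P) (lift_ne_zero Q), proj_lift, proj_lift] at h0
  exact h h0

/-- A quadratic map with a `4`-periodic critical point is conjugate to a normal form, whose
parameter is a cross-ratio of the critical cycle. -/
theorem exists_isNormalForm {F : QuadPair L} (hF : F.Nondeg) {P : OnePoint L}
    (hcrit : F.IsCrit (lift P)) (h4 : F.onLine (F.onLine (F.onLine (F.onLine P))) = P)
    (h2 : F.onLine (F.onLine P) ≠ P) :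
    ∃ (Z W : L × L) (c ρ : L), F.IsNormalForm Z W c ρ ∧ proj Z = P ∧
      c * (det₂ (lift P) (lift (F.onLine (F.onLine (F.onLine P)))) *
        det₂ (lift (F.onLine (F.onLine P))) (lift (F.onLine P))) =
      -(det₂ (lift P) (lift (F.onLine P)) *
        det₂ (lift (F.onLine (F.onLine P))) (lift (F.onLine (F.onLine (F.onLine P))))) := by
  obtain ⟨k0, hk0, e0⟩ := eval_lift hF P
  obtain ⟨k1, hk1, e1⟩ := eval_lift hF (F.onLine P)
  obtain ⟨k2, hk2, e2⟩ := eval_lift hF (F.onLine (F.onLine P))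
  obtain ⟨k3, hk3, e3⟩ := eval_lift hF (F.onLine (F.onLine (F.onLine P)))
  have d03 : P ≠ F.onLine (F.onLine (F.onLine P)) := by
    intro h; rw [← h] at h4; rw [h4] at h2; exact h2 h4
  have d01 : F.onLine P ≠ P := by
    intro h; rw [h] at h2; exact h2 h
  have d13 : F.onLine P ≠ F.onLine (F.onLine (F.onLine P)) := by
    intro h; rw [← h] at h4; exact h2 h4
  have d12 : F.onLine (F.onLine P) ≠ F.onLine P := by
    intro h; rw [h] at d13; exact d13 h.symm
  have d23 : F.onLine (F.onLine P) ≠ F.onLine (F.onLine (F.onLine P)) := by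
    intro h; rw [← h] at h4; rw [← h] at h4; exact h2 h4
  have D03 := det₂_lift_ne_zero d03
  have D01 := det₂_lift_ne_zero d01.symm
  have D13 := det₂_lift_ne_zero d13
  have D23 := det₂_lift_ne_zero d23
  have D02 := det₂_lift_ne_zero h2.symm
  have D21 := det₂_lift_ne_zero d12
  rw [h4] at e3
  generalize lift (F.onLine (F.onLine (F.onLine P))) = l3 at *
  generalize lift (F.onLine (F.onLine P)) = l2 at *
  generalize lift (F.onLine P) = l1 at *
  have hP := proj_lift P
  have hl0 := lift_ne_zero P
  generalize lift P = l0 at *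
  obtain ⟨p, q, rfl⟩ := exists_combination D03 l1
  obtain ⟨r, s, rfl⟩ := exists_combination D03 l2
  have c01 : det₂ l0 (p • l0 + q • l3) = q * det₂ l0 l3 := by
    simpa using det₂_combination l0 l3 1 0 p q
  have c13 : det₂ (p • l0 + q • l3) l3 = p * det₂ l0 l3 := by
    simpa using det₂_combination l0 l3 p q 0 1
  have c02 : det₂ l0 (r • l0 + s • l3) = s * det₂ l0 l3 := by
    simpa using det₂_combination l0 l3 1 0 r s
  have c23 : det₂ (r • l0 + s • l3) l3 = r * det₂ l0 l3 := by
    simpa using det₂_combination l0 l3 r s 0 1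
  have c21 := det₂_combination l0 l3 r s p q
  have hq : q ≠ 0 := by rintro rfl; rw [c01, zero_mul] at D01; exact D01 rfl
  have hp : p ≠ 0 := by rintro rfl; rw [c13, zero_mul] at D13; exact D13 rfl
  have hs : s ≠ 0 := by rintro rfl; rw [c02, zero_mul] at D02; exact D02 rfl
  have hr : r ≠ 0 := by rintro rfl; rw [c23, zero_mul] at D23; exact D23 rfl
  obtain ⟨n, hn⟩ : ∃ n, n = p * s - q * r := ⟨_, rfl⟩
  have hn0 : n ≠ 0 := by
    rintro rfl
    apply D21
    rw [c21, show r * q - s * p = 0 by linear_combination hn, zero_mul]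
  -- With Z = α l0 and W = l3, the points l1 and l2 have coordinates p/(qα) and r/(sα). These must
  -- be c+1 and c, so α = p/q − r/s and c = r/(sα).
  obtain ⟨α, hα⟩ : ∃ α, α = n / (q * s) := ⟨_, rfl⟩
  obtain ⟨c, hc⟩ : ∃ c, c = r * q / n := ⟨_, rfl⟩
  have hα0 : α ≠ 0 := hα ▸ div_ne_zero hn0 (mul_ne_zero hq hs)
  have hc0 : c ≠ 0 := hc ▸ div_ne_zero (mul_ne_zero hr hq) hn0
  have hc' : c + 1 = p * s / n := by
    rw [hc]
    field_simp
    linear_combination hn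
  have hc1 : c + 1 ≠ 0 := hc' ▸ div_ne_zero (mul_ne_zero hp hs) hn0
  have hp' : q * ((c + 1) * α) = p := by rw [hc', hα]; field_simp
  have hr' : s * (c * α) = r := by rw [hc, hα]; field_simp
  obtain ⟨Z, hZ⟩ : ∃ Z, Z = α • l0 := ⟨_, rfl⟩
  have hZ0 : l0 = α⁻¹ • Z := by rw [hZ, smul_smul, inv_mul_cancel₀ hα0, one_smul]
  have hdet : det₂ Z l3 ≠ 0 := by
    have : det₂ Z l3 = α * det₂ l0 l3 := by simp [det₂, hZ]; ring
    rw [this]; exact mul_ne_zero hα0 D03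
  have hl1 : p • l0 + q • l3 = q • ((c + 1) • Z + l3) := by
    rw [hZ, smul_add, smul_smul, smul_smul, mul_assoc, hp']
  have hl2 : r • l0 + s • l3 = s • (c • Z + l3) := by
    rw [hZ, smul_add, smul_smul, smul_smul, mul_assoc, hr']
  have hcross : c * (det₂ l0 l3 * det₂ (r • l0 + s • l3) (p • l0 + q • l3)) =
      -(det₂ l0 (p • l0 + q • l3) * det₂ (r • l0 + s • l3) l3) := by
    rw [c21, c01, c23, hc]
    field_simp
    linear_combination hn
  have U0 : (c + 1) • Z + l3 ≠ 0 := by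
    simpa using combination_ne_zero hdet (x := c + 1) (y := 1) (Or.inr one_ne_zero)
  obtain ⟨K0, hK0, E0⟩ : ∃ K : L, K ≠ 0 ∧ F.eval Z = K • ((c + 1) • Z + l3) := by
    refine ⟨α ^ 2 * k0 * q, by positivity, ?_⟩
    rw [show F.eval Z = F.eval (α • l0) by rw [hZ], eval_smul, e0, hl1, smul_smul, smul_smul,
      mul_assoc]
  obtain ⟨K3, E3⟩ : ∃ K : L, F.eval l3 = K • Z := ⟨k3 * α⁻¹, by rw [e3, hZ0, smul_smul]⟩
  -- Criticality of Z makes the polar form at Z parallel to F(Z); only the three scalars K0, E and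
  -- K3 are left unknown.
  obtain ⟨E, EB⟩ : ∃ K : L, F.polar Z l3 = K • ((c + 1) • Z + l3) := by
    refine exists_smul_of_det₂_eq_zero U0 ?_
    have := hcrit.smul α l3
    rw [← hZ, E0] at this
    have h' : K0 * det₂ (F.polar Z l3) ((c + 1) • Z + l3) = 0 := by
      rw [← this]; simp only [det₂, Prod.smul_fst, Prod.smul_snd, smul_eq_mul]; ring
    exact (mul_eq_zero.1 h').resolve_left hK0
  have hgen : ∀ x y : L, F.eval (x • Z + y • l3) =
      ((c + 1) * (K0 * x ^ 2 + E * (x * y)) + K3 * y ^ 2) • Z + (K0 * x ^ 2 + E * (x * y)) • l3 := by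
    intro x y
    rw [eval_combination, E0, EB, E3]
    module
  obtain ⟨κ, eκ⟩ : ∃ κ : L, F.eval ((c + 1) • Z + (1 : L) • l3) = (κ * c) • Z + κ • l3 := by
    refine ⟨k1 * s / q ^ 2, ?_⟩
    rw [hl1, eval_smul, hl2] at e1
    have : F.eval ((c + 1) • Z + l3) = (q ^ 2)⁻¹ • (k1 • s • (c • Z + l3)) := by
      rw [← e1, smul_smul, inv_mul_cancel₀ (pow_ne_zero 2 hq), one_smul]
    rw [one_smul, this, div_eq_inv_mul]
    module
  obtain ⟨μ, eμ⟩ : ∃ μ : L, F.eval (c • Z + (1 : L) • l3) = (0 : L) • Z + μ • l3 := by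
    refine ⟨(s ^ 2)⁻¹ * k2, ?_⟩
    rw [hl2, eval_smul] at e2
    rw [one_smul, zero_smul, zero_add, mul_smul, ← e2, smul_smul,
      inv_mul_cancel₀ (pow_ne_zero 2 hs), one_smul]
  rw [hgen] at eκ eμ
  obtain ⟨q1, q2⟩ := combination_injective hdet eκ
  obtain ⟨q3, -⟩ := combination_injective hdet eμ
  -- Eliminating κ and K3 from c+1 ↦ c and c ↦ 0 fixes E/K0. If c = 1 the same relation would force
  -- K0 = 0.
  have hE : E * (c - 1) = K0 * (1 + c - c ^ 2) := by
    have : (c + 1) * (E * (c - 1) - K0 * (1 + c - c ^ 2)) = 0 := by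
      linear_combination q3 - q1 + c * q2
    exact sub_eq_zero.1 ((mul_eq_zero.1 this).resolve_left hc1)
  have hcne : c - 1 ≠ 0 := by
    intro h
    have h1 : c = 1 := sub_eq_zero.1 h
    rw [h1] at hE
    apply hK0
    linear_combination -hE
  refine ⟨Z, l3, c, K0 / (c - 1), ⟨hdet, div_ne_zero hK0 hcne, hc0, sub_ne_zero.1 hcne,
    fun h => hc1 (by rw [h]; ring), ?_⟩, ?_, hcross⟩
  · intro x y
    have hE' : E = K0 / (c - 1) * (1 + c - c ^ 2) := by field_simp; exact hE
    have hK : K0 = K0 / (c - 1) * (c - 1) := by field_simp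
    have hK3 : K3 = -(K0 / (c - 1) * (c * (c + 1))) := by
      generalize K0 / (c - 1) = t at *
      subst hK hE'
      linear_combination q3
    rw [hgen]
    generalize K0 / (c - 1) = t at *
    subst hK hE' hK3
    simp only [normalMap]
    module
  · rw [hZ, proj_smul hα0 hl0, hP]

namespace IsNormalForm

variable {F : QuadPair L} {Z W : L × L} {c ρ : L}

/-- The critical points of a normal form. -/
lemma eq_of_isCrit [CharZero L] (h : F.IsNormalForm Z W c ρ) {P : OnePoint L} (hcrit : F.IsCrit (lift P))
    (hP : P ≠ proj Z) : P = proj ((1 + c - c ^ 2) • Z + (2 * (1 - c)) • W) := by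
  have hZ := ne_zero_of_det₂_left h.det_ne
  obtain ⟨x, y, hxy⟩ := exists_combination h.det_ne (lift P)
  have hy : y ≠ 0 := by
    rintro rfl
    apply hP
    rw [← proj_lift P, hxy]
    have hx : x ≠ 0 := by
      rintro rfl
      exact lift_ne_zero P (by rw [hxy]; simp)
    rw [zero_smul, add_zero, proj_smul hx hZ]
  have hEZ : F.eval Z = (ρ * (c - 1) * (c + 1)) • Z + (ρ * (c - 1)) • W := by
    have := h.eval_eq 1 0
    simp only [normalMap] at this
    rw [one_smul, zero_smul, add_zero] at this
    rw [this]
    module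
  have hEW : F.eval W = (-(ρ * (c + 1) * c)) • Z + (0 : L) • W := by
    have := h.eval_eq 0 1
    simp only [normalMap] at this
    rw [one_smul, zero_smul, zero_add] at this
    rw [this]
    module
  -- By polarization, the direction Z alone detects criticality away from Z.
  have hB : F.polar (x • Z + y • W) Z =
      (ρ * (2 * x * (c - 1) + y * (1 + c - c ^ 2)) * (c + 1)) • Z +
        (ρ * (2 * x * (c - 1) + y * (1 + c - c ^ 2))) • W := by
    have h1 : F.polar (x • Z + y • W) Z =
        (2 * x) • F.eval Z + y • (F.eval ((1 : L) • Z + (1 : L) • W) - F.eval Z - F.eval W) := by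
      ext <;> simp [polar, eval] <;> ring
    rw [h1, h.eval_eq, hEZ, hEW]
    simp only [normalMap]
    module
  have h0 := hcrit Z
  rw [hxy, hB, h.eval_eq] at h0
  simp only [smul_add, smul_smul] at h0
  rw [det₂_combination] at h0
  have h1 := (mul_eq_zero.1 h0).resolve_right h.det_ne
  simp only [normalMap] at h1
  have h2 : ρ ^ 2 * c * (c + 1) * y ^ 2 * (2 * x * (c - 1) + y * (1 + c - c ^ 2)) = 0 := by
    linear_combination h1
  have hc1 : c + 1 ≠ 0 := fun h' => h.ne_neg_one (eq_neg_of_add_eq_zero_left h')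
  have h3 : 2 * x * (c - 1) + y * (1 + c - c ^ 2) = 0 := by
    refine (mul_eq_zero.1 h2).resolve_left ?_
    exact mul_ne_zero (mul_ne_zero (mul_ne_zero (pow_ne_zero 2 h.scale_ne) h.ne_zero) hc1)
      (pow_ne_zero 2 hy)
  have hc2 : 2 * (1 - c) ≠ 0 := mul_ne_zero two_ne_zero (sub_ne_zero.2 h.ne_one.symm)
  have hv := combination_ne_zero h.det_ne (x := 1 + c - c ^ 2) (Or.inr hc2)
  rw [← proj_lift P, RatDyn.proj_eq_proj_iff (lift_ne_zero P) hv, hxy, det₂_combination]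
  rw [show x * (2 * (1 - c)) - y * (1 + c - c ^ 2) = 0 by linear_combination -h3, zero_mul]

/-- One step of the dynamics in normal coordinates. -/
lemma onLine_eq (h : F.IsNormalForm Z W c ρ) (hF : F.Nondeg) {z z' : L × L} {k : L} (hz : z ≠ 0)
    (hk : normalMap c z = k • z') :
    z' ≠ 0 ∧ F.onLine (proj (z.1 • Z + z.2 • W)) = proj (z'.1 • Z + z'.2 • W) := by
  have hz' : z.1 ≠ 0 ∨ z.2 ≠ 0 := by
    by_contra hh
    push Not at hh
    exact hz (Prod.ext hh.1 hh.2)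
  have hv := combination_ne_zero h.det_ne hz'
  have he : F.eval (z.1 • Z + z.2 • W) = (ρ * k) • (z'.1 • Z + z'.2 • W) := by
    rw [h.eval_eq, hk, Prod.smul_fst, Prod.smul_snd, smul_eq_mul, smul_eq_mul]
    module
  -- Nondegeneracy makes both the scalar and z' nonzero, so the common factors removed along the
  -- orbit need no separate check.
  have h0 := hF _ hv
  rw [he] at h0
  have hρk : ρ * k ≠ 0 := fun h' => h0 (by rw [h', zero_smul])
  have hv' : z'.1 • Z + z'.2 • W ≠ 0 := fun h' => h0 (by rw [h', smul_zero])
  refine ⟨?_, ?_⟩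
  · rintro rfl
    simp at hv'
  · rw [onLine_proj hF hv, he, proj_smul hρk hv']

lemma proj_eq_proj_iff (h : F.IsNormalForm Z W c ρ) {z w : L × L} (hz : z ≠ 0) (hw : w ≠ 0) :
    proj (z.1 • Z + z.2 • W) = proj (w.1 • Z + w.2 • W) ↔ det₂ z w = 0 := by
  have aux : ∀ {z : L × L}, z ≠ 0 → z.1 ≠ 0 ∨ z.2 ≠ 0 := by
    intro z hz
    by_contra hh
    push Not at hh
    exact hz (Prod.ext hh.1 hh.2)
  rw [RatDyn.proj_eq_proj_iff (combination_ne_zero h.det_ne (aux hz))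
    (combination_ne_zero h.det_ne (aux hw)), det₂_combination, mul_eq_zero,
    or_iff_left h.det_ne, det₂]

/-- If the second critical point of a normal form is `4`-periodic, then its parameter is a root of
one of four explicit polynomials. -/
theorem parameter_eq_zero [CharZero L] (h : F.IsNormalForm Z W c ρ) (hF : F.Nondeg)
    {P : OnePoint L} (hcrit : F.IsCrit (lift P)) (hP : P ≠ proj Z)
    (h4 : F.onLine (F.onLine (F.onLine (F.onLine P))) = P) (h2 : F.onLine (F.onLine P) ≠ P) :
    1 + c - c ^ 2 = 0 ∨ c ^ 2 + c - 1 = 0 ∨ c ^ 2 - c + 1 = 0 ∨ secondCritPoly c = 0 := by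
  have hz : ((1 + c - c ^ 2, 2 * (1 - c)) : L × L) ≠ 0 := by
    intro h'
    have := congrArg Prod.snd h'
    simp only [Prod.snd_zero, mul_eq_zero, OfNat.ofNat_ne_zero, false_or] at this
    exact h.ne_one (sub_eq_zero.1 this).symm
  have e0 := h.eq_of_isCrit hcrit hP
  obtain ⟨z1, e1⟩ := h.onLine_eq hF hz (normalMap_critOrbit0 c)
  obtain ⟨z2, e2⟩ := h.onLine_eq hF z1 (normalMap_critOrbit1 c)
  obtain ⟨z3, e3⟩ := h.onLine_eq hF z2 (normalMap_critOrbit2 c)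
  obtain ⟨z4, e4⟩ := h.onLine_eq hF z3 (normalMap_critOrbit3 c)
  rw [e0, e1, e2] at h2
  rw [e0, e1, e2, e3, e4] at h4
  rw [h.proj_eq_proj_iff z4 hz, det₂_critOrbit4] at h4
  have h2' := mt (h.proj_eq_proj_iff z2 hz).2 h2
  have hc1 : c - 1 ≠ 0 := sub_ne_zero.2 h.ne_one
  simpa [h2', hc1, or_assoc] using h4

end IsNormalForm

end QuadPair

/-! ### The polynomial of degree 20 has no root of degree at most two -/

/-- Evaluation of a polynomial, given by the list of its coefficients, by Horner's rule. -/
def horner {R : Type*} [CommRing R] (x : R) (l : List R) : R :=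
  l.foldl (fun p a => p * x + a) 0

/-- Horner's rule at a root `x` of `X ^ 2 - s X - t`, in the basis `x, 1`. -/
def hornerQuad {R : Type*} [CommRing R] (s t : R) (l : List R) : R × R :=
  l.foldl (fun p a => (p.1 * s + p.2, p.1 * t + a)) (0, 0)

/-- The pair carried along is the remainder modulo X² − sX − t, so a polynomial relation for a
quadratic x becomes a linear one with coefficients in the base ring. -/
lemma horner_eq_hornerQuad {R A : Type*} [CommRing R] [CommRing A] (f : R →+* A) {x : A} {s t : R}
    (hx : x ^ 2 = f s * x + f t) (l : List R) :
    horner x (l.map f) = f (hornerQuad s t l).1 * x + f (hornerQuad s t l).2 := by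
  have key : ∀ (l : List R) (p : R × R),
      (l.map f).foldl (fun p a => p * x + a) (f p.1 * x + f p.2) =
        f (l.foldl (fun p a => (p.1 * s + p.2, p.1 * t + a)) p).1 * x +
          f (l.foldl (fun p a => (p.1 * s + p.2, p.1 * t + a)) p).2 := by
    intro l
    induction l with
    | nil => intro p; rfl
    | cons a l ih =>
      intro p
      rw [List.map_cons, List.foldl_cons, List.foldl_cons, ← ih]
      congr 1
      simp only [map_add, map_mul]
      linear_combination f p.1 * hx
  simpa [horner, hornerQuad] using key l (0, 0)

lemma horner_map {R A : Type*} [CommRing R] [CommRing A] (f : R →+* A) (x : R) (l : List R) :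
    horner (f x) (l.map f) = f (horner x l) := by
  have key : ∀ (l : List R) (p : R), (l.map f).foldl (fun p a => p * f x + a) (f p) =
      f (l.foldl (fun p a => p * x + a) p) := by
    intro l
    induction l with
    | nil => intro p; rfl
    | cons a l ih =>
      intro p
      rw [List.map_cons, List.foldl_cons, List.foldl_cons, ← ih, map_add, map_mul]
  simpa [horner] using key l 0

lemma hornerQuad_map {R A : Type*} [CommRing R] [CommRing A] (f : R →+* A) (s t : R)
    (l : List R) :
    hornerQuad (f s) (f t) (l.map f) = (f (hornerQuad s t l).1, f (hornerQuad s t l).2) := by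
  have key : ∀ (l : List R) (p : R × R),
      (l.map f).foldl (fun p a => (p.1 * f s + p.2, p.1 * f t + a)) (f p.1, f p.2) =
        (f (l.foldl (fun p a => (p.1 * s + p.2, p.1 * t + a)) p).1,
          f (l.foldl (fun p a => (p.1 * s + p.2, p.1 * t + a)) p).2) := by
    intro l
    induction l with
    | nil => intro p; rfl
    | cons a l ih =>
      intro p
      rw [List.map_cons, List.foldl_cons, List.foldl_cons, ← ih]
      simp only [map_add, map_mul]
  simpa [hornerQuad] using key l (0, 0)

/-- The coefficients of the monic polynomial `2 ^ 19 * secondCritPoly (X / 2)`. -/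
def secondCritCoeffs : List ℤ :=
  [1, -8, 14, 88, -608, 1728, -384, -17536, 58624, -30208, -250368, 722944, -774144,
    -1204224, 6553600, -8192000, -6684672, 25034752, -16384000, -5242880, 7340032]

lemma horner_secondCritCoeffs {A : Type*} [CommRing A] (c : A) :
    horner (2 * c) (secondCritCoeffs.map (Int.castRingHom A)) = 2 ^ 19 * secondCritPoly c := by
  simp only [horner, secondCritCoeffs, secondCritPoly, List.map_cons, List.map_nil,
    List.foldl_cons, List.foldl_nil, eq_intCast]
  push_cast
  ring

lemma secondCritCoeffs_map_zmod :
    secondCritCoeffs.map (Int.castRingHom (ZMod 3)) =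
      [1, 1, 2, 1, 1, 0, 0, 2, 1, 2, 0, 1, 0, 0, 1, 1, 0, 1, 2, 1, 1] := by
  simp only [secondCritCoeffs, List.map_cons, List.map_nil, eq_intCast]
  norm_num
  reduce_mod_char
  trivial

lemma horner_zmod_ne_zero (x : ZMod 3) :
    horner x (secondCritCoeffs.map (Int.castRingHom (ZMod 3))) ≠ 0 := by
  rw [secondCritCoeffs_map_zmod]
  revert x
  unfold horner
  decide

/-- All nine monic quadratics over the field with three elements are tried, reducible ones included,
so irreducibility of the minimal polynomial modulo 3 is not an issue. -/
lemma hornerQuad_zmod_ne_zero (s t : ZMod 3) :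
    hornerQuad s t (secondCritCoeffs.map (Int.castRingHom (ZMod 3))) ≠ 0 := by
  rw [secondCritCoeffs_map_zmod]
  revert s t
  unfold hornerQuad
  decide

lemma map_secondCritPoly {A B F : Type*} [CommRing A] [CommRing B] [FunLike F A B]
    [RingHomClass F A B] (f : F) (c : A) : f (secondCritPoly c) = secondCritPoly (f c) := by
  simp only [secondCritPoly, map_add, map_sub, map_mul, map_pow, map_ofNat]

/-- The polynomial `secondCritPoly` has no irreducible factor of degree at most two over `ℚ`: its
irreducible factors modulo `3` have degrees `3, 3, 7, 7`. -/
theorem secondCritPoly_ne_zero {K : Type*} [Field K] [Algebra ℚ K] [FiniteDimensional ℚ K]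
    (hK : Module.finrank ℚ K ≤ 2) (c : K) : secondCritPoly c ≠ 0 := by
  intro h0
  have : CharZero K := algebraRat.charZero K
  -- The leading coefficient is 2, so doubling the root makes it integral; its minimal polynomial
  -- over ℤ can then be reduced modulo 3.
  have hint : IsIntegral ℤ (2 * c) := by
    have hdeg : (secondCritPoly (X : ℤ[X])).natDegree = 20 := by
      unfold secondCritPoly
      compute_degree!
    have hlead : (secondCritPoly (X : ℤ[X])).leadingCoeff = 2 := by
      rw [leadingCoeff, hdeg]
      unfold secondCritPoly
      compute_degree!
    have := isIntegral_leadingCoeff_smul (secondCritPoly (X : ℤ[X])) c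
      (by rw [← h0, map_secondCritPoly, aeval_X])
    rw [hlead] at this
    simpa using this
  obtain ⟨γ, hγ⟩ : ∃ γ, γ = 2 * c := ⟨_, rfl⟩
  have hroot : horner γ (secondCritCoeffs.map (Int.castRingHom K)) = 0 := by
    rw [hγ, horner_secondCritCoeffs, h0, mul_zero]
  rw [← hγ] at hint
  have hmon := minpoly.monic hint
  have hroot' := minpoly.aeval ℤ γ
  have hle : (minpoly ℤ γ).natDegree ≤ 2 := by
    rw [← hmon.natDegree_map (algebraMap ℤ ℚ),
      ← minpoly.isIntegrallyClosed_eq_field_fractions' ℚ hint]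
    exact (minpoly.natDegree_le γ).trans hK
  have hpos := minpoly.natDegree_pos hint
  have hcases : (minpoly ℤ γ).natDegree = 1 ∨ (minpoly ℤ γ).natDegree = 2 := by omega
  rcases hcases with h | h
  · have hc1 : (minpoly ℤ γ).coeff 1 = 1 := by rw [← h]; exact hmon
    rw [aeval_eq_sum_range, h] at hroot'
    simp only [Finset.sum_range_succ, Finset.sum_range_zero, hc1] at hroot'
    have hγ' : γ = Int.castRingHom K (-(minpoly ℤ γ).coeff 0) := by
      simp only [eq_intCast, Int.cast_neg]
      simp at hroot'
      linear_combination hroot'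
    rw [hγ', horner_map, eq_intCast, Int.cast_eq_zero] at hroot
    refine horner_zmod_ne_zero (Int.castRingHom (ZMod 3) (-(minpoly ℤ γ).coeff 0)) ?_
    rw [horner_map, hroot, map_zero]
  · have hc2 : (minpoly ℤ γ).coeff 2 = 1 := by rw [← h]; exact hmon
    rw [aeval_eq_sum_range, h] at hroot'
    simp only [Finset.sum_range_succ, Finset.sum_range_zero, hc2] at hroot'
    generalize hs : (minpoly ℤ γ).coeff 1 = s at hroot'
    generalize ht : (minpoly ℤ γ).coeff 0 = t at hroot'
    have hγ' : γ ^ 2 = Int.castRingHom K (-s) * γ + Int.castRingHom K (-t) := by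
      simp only [eq_intCast, Int.cast_neg]
      simp at hroot'
      linear_combination hroot'
    rw [horner_eq_hornerQuad (Int.castRingHom K) hγ'] at hroot
    generalize hp : hornerQuad (-s) (-t) secondCritCoeffs = p at hroot
    -- The remainder has degree at most 1 and is divisible by a minimal polynomial of degree 2, so
    -- it vanishes over ℤ and therefore modulo 3.
    have hdvd : minpoly ℤ γ ∣ C p.1 * X + C p.2 :=
      minpoly.isIntegrallyClosed_dvd hint (by simpa using hroot)
    have hzero : C p.1 * X + C p.2 = 0 := by
      by_contra hne
      have h1 := natDegree_le_of_dvd hdvd hne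
      have h2 : (C p.1 * X + C p.2).natDegree ≤ 1 := natDegree_linear_le
      omega
    have hp1 : p.1 = 0 := by
      have := congrArg (fun f => coeff f 1) hzero
      simpa only [coeff_add, coeff_C_mul, coeff_X_one, coeff_C_succ, mul_one, add_zero,
        coeff_zero] using this
    have hp2 : p.2 = 0 := by simpa using congrArg (fun f => coeff f 0) hzero
    refine hornerQuad_zmod_ne_zero (Int.castRingHom (ZMod 3) (-s))
      (Int.castRingHom (ZMod 3) (-t)) ?_
    rw [hornerQuad_map, hp, hp1, hp2, map_zero]
    rfl

/-! ### Change of field -/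

section Functoriality

variable {L L' : Type*} [Field L] [Field L']

/-- The map on `ℙ¹` induced by a homomorphism of fields. -/
def mapPt (f : L →+* L') : OnePoint L → OnePoint L'
  | none => OnePoint.infty
  | some x => ((f x : L') : OnePoint L')

lemma mapPt_infty (f : L →+* L') : mapPt f OnePoint.infty = OnePoint.infty := rfl

lemma mapPt_coe (f : L →+* L') (x : L) : mapPt f (x : OnePoint L) = ((f x : L') : OnePoint L') :=
  rfl

lemma lift_mapPt (f : L →+* L') (P : OnePoint L) :
    lift (mapPt f P) = (f (lift P).1, f (lift P).2) := by
  cases P with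
  | infty => change ((1, 0) : L' × L') = (f 1, f 0); simp
  | coe x => change ((f x, 1) : L' × L') = (f x, f 1); simp

lemma proj_map (f : L →+* L') (z : L × L) : proj (f z.1, f z.2) = mapPt f (proj z) := by
  by_cases h : z.2 = 0
  · simp [proj, h, mapPt_infty]
  · simp [proj, h, mapPt_coe]

lemma mapPt_injective (f : L →+* L') : Function.Injective (mapPt f) := by
  intro P Q h
  cases P <;> cases Q <;> simp_all [mapPt_infty, mapPt_coe]
  exact f.injective h

lemma det₂_map (f : L →+* L') (z w : L × L) :
    det₂ (f z.1, f z.2) (f w.1, f w.2) = f (det₂ z w) := by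
  simp [det₂]

namespace QuadPair

/-- The image of a pair of forms under a homomorphism of fields. -/
def map (f : L →+* L') (F : QuadPair L) : QuadPair L' :=
  ⟨f F.a, f F.b, f F.c, f F.d, f F.e, f F.f⟩

lemma eval_map (f : L →+* L') (F : QuadPair L) (z : L × L) :
    (F.map f).eval (f z.1, f z.2) = (f (F.eval z).1, f (F.eval z).2) := by
  simp [eval, map]

lemma polar_map (f : L →+* L') (F : QuadPair L) (z w : L × L) :
    (F.map f).polar (f z.1, f z.2) (f w.1, f w.2) = (f (F.polar z w).1, f (F.polar z w).2) := by
  simp [polar, map, map_ofNat]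

lemma onLine_map (f : L →+* L') (F : QuadPair L) (P : OnePoint L) :
    (F.map f).onLine (mapPt f P) = mapPt f (F.onLine P) := by
  rw [onLine, lift_mapPt, eval_map, proj_map, onLine]

lemma isCrit_of_map {f : L →+* L'} {F : QuadPair L} {P : OnePoint L}
    (h : (F.map f).IsCrit (lift (mapPt f P))) : F.IsCrit (lift P) := by
  intro w
  have := h (f w.1, f w.2)
  rw [lift_mapPt, polar_map, eval_map, det₂_map] at this
  exact (map_eq_zero f).1 this

/-- Criticality at the image of `z` under an isomorphism of fields. -/
lemma IsCrit.map {F : QuadPair L} {P : OnePoint L} (h : F.IsCrit (lift P)) (f : L ≃+* L') :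
    (F.map (f : L →+* L')).IsCrit (lift (mapPt (f : L →+* L') P)) := by
  intro w
  -- Criticality is tested against every vector over L'; surjectivity of f pulls each one back to L.
  have hw : w = ((f : L →+* L') (f.symm w.1, f.symm w.2).1,
      (f : L →+* L') (f.symm w.1, f.symm w.2).2) := by simp
  rw [hw, lift_mapPt, polar_map, eval_map, det₂_map, h, map_zero]

end QuadPair

end Functoriality

/-! ### Rational functions of degree two as pairs of forms -/

section OfRatFunc

variable {K : Type*} [Field K] (L : Type*) [Field L] [Algebra K L]

/-- The pair of binary quadratic forms attached to a rational function of degree two. -/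
def quadPair (φ : RatFunc K) : QuadPair L :=
  ⟨algebraMap K L (φ.num.coeff 2), algebraMap K L (φ.num.coeff 1), algebraMap K L (φ.num.coeff 0),
    algebraMap K L (φ.denom.coeff 2), algebraMap K L (φ.denom.coeff 1),
    algebraMap K L (φ.denom.coeff 0)⟩

variable {L}

lemma quadPair_map {L' : Type*} [Field L'] [Algebra K L'] (f : L →+* L')
    (hf : f.comp (algebraMap K L) = algebraMap K L') (φ : RatFunc K) :
    (quadPair L φ).map f = quadPair L' φ := by
  have h : ∀ x, f (algebraMap K L x) = algebraMap K L' x := fun x => RingHom.congr_fun hf x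
  simp only [quadPair, QuadPair.map, h]

lemma aeval_of_natDegree_le_two {p : K[X]} (hp : p.natDegree ≤ 2) (x : L) :
    aeval x p = algebraMap K L (p.coeff 2) * x ^ 2 + algebraMap K L (p.coeff 1) * x +
      algebraMap K L (p.coeff 0) := by
  rw [aeval_eq_sum_range' (Nat.lt_succ_of_le hp)]
  simp only [Finset.sum_range_succ, Finset.sum_range_zero, Algebra.smul_def]
  ring

lemma derivative_aeval_of_natDegree_le_two {p : K[X]} (hp : p.natDegree ≤ 2) (x : L) :
    aeval x (derivative p) = 2 * algebraMap K L (p.coeff 2) * x + algebraMap K L (p.coeff 1) := by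
  have h : (derivative p).natDegree < 2 := (natDegree_derivative_le p).trans_lt (by omega)
  rw [aeval_eq_sum_range' h]
  simp only [Finset.sum_range_succ, Finset.sum_range_zero, Algebra.smul_def, coeff_derivative,
    map_mul, map_add, map_one, Nat.cast_zero, Nat.cast_one, map_zero]
  ring

variable {φ : RatFunc K}

lemma natDegree_num_le (hφ : φ ∈ Rat 2 K) : φ.num.natDegree ≤ 2 :=
  (le_max_left _ _).trans_eq hφ

lemma natDegree_denom_le (hφ : φ ∈ Rat 2 K) : φ.denom.natDegree ≤ 2 :=
  (le_max_right _ _).trans_eq hφ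

lemma coeff_two_ne_zero (hφ : φ ∈ Rat 2 K) : φ.num.coeff 2 ≠ 0 ∨ φ.denom.coeff 2 ≠ 0 := by
  have h : max φ.num.natDegree φ.denom.natDegree = 2 := hφ
  rcases max_choice φ.num.natDegree φ.denom.natDegree with h' | h' <;> rw [h'] at h
  · left
    rw [← h]
    exact leadingCoeff_ne_zero.2 fun h0 => by simp [h0] at h
  · right
    rw [← h]
    exact leadingCoeff_ne_zero.2 fun h0 => by simp [h0] at h

lemma aeval_num_or_denom_ne_zero (φ : RatFunc K) (x : L) :
    aeval x φ.num ≠ 0 ∨ aeval x φ.denom ≠ 0 := by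
  by_contra! h
  obtain ⟨u, v, huv⟩ := φ.isCoprime_num_denom
  simpa [h.1, h.2] using congrArg (aeval x) huv

/-- At ∞ one of the two coefficients of x² survives because the degree is exactly 2; at finite
points this is coprimality. -/
lemma quadPair_nondeg (hφ : φ ∈ Rat 2 K) : (quadPair L φ).Nondeg := by
  intro z hz h
  have h1 := congrArg Prod.fst h
  have h2 := congrArg Prod.snd h
  simp only [QuadPair.eval, quadPair, Prod.fst_zero, Prod.snd_zero] at h1 h2
  by_cases hy : z.2 = 0
  · have hx : z.1 ≠ 0 := fun hx => hz (Prod.ext hx hy)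
    rcases coeff_two_ne_zero hφ with h0 | h0
    · simp [hy, hx, h0] at h1
    · simp [hy, hx, h0] at h2
  · rcases aeval_num_or_denom_ne_zero φ (z.1 / z.2) with h0 | h0 <;> apply h0
    · rw [aeval_of_natDegree_le_two (natDegree_num_le hφ)]
      field_simp
      linear_combination h1
    · rw [aeval_of_natDegree_le_two (natDegree_denom_le hφ)]
      field_simp
      linear_combination h2

open Classical in
lemma toMap_infty (hφ : φ ∈ Rat 2 K) : toMap L φ OnePoint.infty =
    if φ.denom.coeff 2 = 0 then OnePoint.infty else
      ((algebraMap K L (φ.num.coeff 2 / φ.denom.coeff 2) : L) : OnePoint L) := by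
  have hd : degree φ = 2 := hφ
  rw [← hd]
  rfl

open Classical in
lemma toMap_coe (φ : RatFunc K) (x : L) : toMap L φ (x : OnePoint L) =
    if aeval x φ.denom = 0 then OnePoint.infty else
      ((aeval x φ.num / aeval x φ.denom : L) : OnePoint L) :=
  rfl

lemma toMap_eq_onLine (hφ : φ ∈ Rat 2 K) : toMap L φ = (quadPair L φ).onLine := by
  funext P
  cases P with
  | infty =>
    rw [toMap_infty hφ]
    change _ = proj ((quadPair L φ).eval (1, 0))
    rw [show (quadPair L φ).eval (1, 0) =
      (algebraMap K L (φ.num.coeff 2), algebraMap K L (φ.denom.coeff 2)) by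
        ext <;> simp [QuadPair.eval, quadPair]]
    by_cases h : φ.denom.coeff 2 = 0 <;> simp [proj, h]
  | coe x =>
    rw [toMap_coe]
    change _ = proj ((quadPair L φ).eval (x, 1))
    rw [show (quadPair L φ).eval (x, 1) = (aeval x φ.num, aeval x φ.denom) by
      rw [aeval_of_natDegree_le_two (natDegree_num_le hφ),
        aeval_of_natDegree_le_two (natDegree_denom_le hφ)]
      ext <;> simp [QuadPair.eval, quadPair]]
    simp only [proj]

lemma IsCriticalPt.isCrit (hφ : φ ∈ Rat 2 K) {P : OnePoint L} (h : IsCriticalPt φ P) :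
    (quadPair L φ).IsCrit (lift P) := by
  have hd : degree φ = 2 := hφ
  intro w
  cases P with
  | infty =>
    have h' : 1 < degree φ - (fibrePoly φ (toMap L φ OnePoint.infty)).natDegree := h
    -- As a form of degree 2, the fibre vanishes doubly at ∞ when its coefficient of x vanishes as
    -- well as that of x².
    have h0 : (fibrePoly φ (toMap L φ OnePoint.infty)).natDegree < 1 := by omega
    have hc1 := coeff_eq_zero_of_natDegree_lt h0
    rw [toMap_infty hφ] at hc1
    change det₂ ((quadPair L φ).polar (1, 0) w) ((quadPair L φ).eval (1, 0)) = 0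
    simp only [det₂, QuadPair.polar, QuadPair.eval, quadPair]
    split_ifs at hc1 with h2
    · have hc1' : algebraMap K L (φ.denom.coeff 1) = 0 := by
        rw [← coeff_map]; exact hc1
      rw [h2, map_zero, hc1']
      ring
    · have hc1' : algebraMap K L (φ.num.coeff 1) -
          algebraMap K L (φ.num.coeff 2 / φ.denom.coeff 2) * algebraMap K L (φ.denom.coeff 1) =
            0 := by
        rw [← hc1]; simp [fibrePoly]
      have h2' : algebraMap K L (φ.denom.coeff 2) ≠ 0 := by simpa using h2
      rw [map_div₀] at hc1'
      field_simp at hc1'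
      linear_combination w.2 * hc1'
  | coe x =>
    have h' : 1 < (fibrePoly φ (toMap L φ (x : OnePoint L))).rootMultiplicity x := h
    have hne : fibrePoly φ (toMap L φ (x : OnePoint L)) ≠ 0 := by
      intro h0
      rw [h0] at h'
      simp at h'
    -- The derivative only sees the direction (1, 0). This is enough: w = w.2 (x, 1) + (w.1 − x w.2)
    -- (1, 0), and the polar form of z with itself is 2F(z), which is parallel to F(z).
    have hder := ((one_lt_rootMultiplicity_iff_isRoot hne).1 h').2
    rw [toMap_coe] at hder
    have hN := aeval_of_natDegree_le_two (natDegree_num_le hφ) x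
    have hD := aeval_of_natDegree_le_two (natDegree_denom_le hφ) x
    have hN' := derivative_aeval_of_natDegree_le_two (natDegree_num_le hφ) x
    have hD' := derivative_aeval_of_natDegree_le_two (natDegree_denom_le hφ) x
    change det₂ ((quadPair L φ).polar (x, 1) w) ((quadPair L φ).eval (x, 1)) = 0
    simp only [det₂, QuadPair.polar, QuadPair.eval, quadPair]
    split_ifs at hder with h2
    · have hder' : aeval x (derivative φ.denom) = 0 := by
        have : eval x (derivative (φ.denom.map (algebraMap K L))) = 0 := hder
        rwa [derivative_map, eval_map_algebraMap] at this
      rw [hD'] at hder'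
      rw [hD] at h2
      generalize algebraMap K L (φ.num.coeff 2) = a, algebraMap K L (φ.num.coeff 1) = b,
        algebraMap K L (φ.num.coeff 0) = c
      linear_combination (2 * a * x * w.1 + b * (x * w.2 + w.1) + 2 * c * w.2 -
        2 * w.2 * (a * x ^ 2 + b * x + c)) * h2 -
        (w.1 - x * w.2) * (a * x ^ 2 + b * x + c) * hder'
    · have hder' : aeval x (derivative φ.num) -
          aeval x φ.num / aeval x φ.denom * aeval x (derivative φ.denom) = 0 := by
        have : eval x (derivative (φ.num.map (algebraMap K L) -
          C (aeval x φ.num / aeval x φ.denom) * φ.denom.map (algebraMap K L))) = 0 := hder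
        simpa [derivative_map, eval_map_algebraMap] using this
      field_simp at hder'
      rw [hN, hD, hN', hD'] at hder'
      linear_combination (w.1 - x * w.2) * hder'

end OfRatFunc

/-! ### Rationality of the 4-periodic critical point -/

namespace QuadPair

variable {L : Type*} [Field L]

/-- `P` is a critical point of `F` of exact period four. -/
structure IsCritFour (F : QuadPair L) (P : OnePoint L) : Prop where
  crit : F.IsCrit (lift P)
  four : F.onLine (F.onLine (F.onLine (F.onLine P))) = P
  two : F.onLine (F.onLine P) ≠ P

/-- Descent: the defining equations and the inequality are all reflected by an injective map of
fields. -/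
lemma isCritFour_of_map {L' : Type*} [Field L'] {f : L →+* L'} {F : QuadPair L} {P : OnePoint L}
    (h : (F.map f).IsCritFour (mapPt f P)) : F.IsCritFour P := by
  obtain ⟨h1, h2, h3⟩ := h
  simp only [onLine_map] at h2 h3
  exact ⟨isCrit_of_map h1, mapPt_injective f h2, fun h => h3 (congrArg _ h)⟩

lemma IsCritFour.map {L' : Type*} [Field L'] {F : QuadPair L} {P : OnePoint L}
    (h : F.IsCritFour P) (f : L ≃+* L') :
    (F.map (f : L →+* L')).IsCritFour (mapPt (f : L →+* L') P) := by
  obtain ⟨h1, h2, h3⟩ := h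
  refine ⟨h1.map f, ?_, ?_⟩
  · simp only [onLine_map, h2]
  · simp only [onLine_map]
    exact fun h => h3 (mapPt_injective _ h)

namespace IsNormalForm

variable {F : QuadPair L} {Z W : L × L} {c ρ : L}

/-- The critical cycle of a normal form. -/
lemma orbit (h : F.IsNormalForm Z W c ρ) (hF : F.Nondeg) :
    F.onLine (proj Z) = proj ((c + 1) • Z + W) ∧
      F.onLine (F.onLine (proj Z)) = proj (c • Z + W) ∧
      F.onLine (F.onLine (F.onLine (proj Z))) = proj W := by
  obtain ⟨z1, e1⟩ := h.onLine_eq hF (z := (1, 0)) (z' := (c + 1, 1)) (k := c - 1) (by simp)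
    (by ext <;> simp [normalMap, mul_comm])
  obtain ⟨z2, e2⟩ := h.onLine_eq hF (z' := (c, 1)) (k := c * (c + 1)) z1
    (by ext <;> simp [normalMap] <;> ring)
  obtain ⟨z3, e3⟩ := h.onLine_eq hF (z' := (0, 1)) (k := c) z2
    (by ext <;> simp only [normalMap, Prod.smul_mk, smul_eq_mul] <;> ring)
  simp only [one_smul, zero_smul, add_zero, zero_add] at e1 e2 e3
  exact ⟨e1, by rw [e1, e2], by rw [e1, e2, e3]⟩

end IsNormalForm

/-- A `4`-periodic critical point, defined over a quadratic field `K`, of a quadratic map with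
Galois-invariant coefficients is fixed by every automorphism of `K`. -/
theorem IsCritFour.mapPt_eq {K : Type*} [Field K] [Algebra ℚ K] [FiniteDimensional ℚ K]
    [IsGalois ℚ K] (hK : Module.finrank ℚ K ≤ 2) {F : QuadPair K} (hF : F.Nondeg)
    (hinv : ∀ σ : K ≃ₐ[ℚ] K, F.map (σ : K →+* K) = F) {P : OnePoint K} (hP : F.IsCritFour P)
    (σ : K ≃ₐ[ℚ] K) : mapPt (σ : K →+* K) P = P := by
  have : CharZero K := algebraRat.charZero K
  obtain ⟨Z, W, c, ρ, hN, hZ, hcross⟩ := exists_isNormalForm hF hP.crit hP.four hP.two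
  obtain ⟨o1, o2, o3⟩ := hN.orbit hF
  rw [hZ] at o1 o2 o3
  have hmap : ∀ (σ : K ≃ₐ[ℚ] K) (Q : OnePoint K),
      F.onLine (mapPt (σ : K →+* K) Q) = mapPt (σ : K →+* K) (F.onLine Q) := by
    intro σ Q
    rw [← onLine_map, hinv]
  have hconj : ∀ σ : K ≃ₐ[ℚ] K, F.IsCritFour (mapPt (σ : K →+* K) P) := by
    intro σ
    have := hP.map σ.toRingEquiv
    rwa [show F.map (σ.toRingEquiv : K →+* K) = F from hinv σ] at this
  have hsecond : ∀ Q, F.IsCritFour Q → Q ≠ P →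
      Q = proj ((1 + c - c ^ 2) • Z + (2 * (1 - c)) • W) := by
    intro Q hQ hne
    exact hN.eq_of_isCrit hQ.crit (hZ ▸ hne)
  -- There are only two critical points: were σ²P different from P, it would be the second one,
  -- namely σP, and injectivity would give σP = P.
  have hinvol : ∀ σ : K ≃ₐ[ℚ] K, mapPt (σ : K →+* K) P ≠ P →
      mapPt (σ : K →+* K) (mapPt (σ : K →+* K) P) = P := by
    intro σ hσ
    by_contra hne
    have h1 := hsecond _ (hconj σ) hσ
    have h2 : F.IsCritFour (mapPt (σ : K →+* K) (mapPt (σ : K →+* K) P)) := by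
      have := (hconj σ).map σ.toRingEquiv
      rwa [show F.map (σ.toRingEquiv : K →+* K) = F from hinv σ] at this
    exact hσ (mapPt_injective _ ((hsecond _ h2 hne).trans h1.symm))
  have hz : ((1 + c - c ^ 2, 2 * (1 - c)) : K × K) ≠ 0 := by
    intro h'
    have := congrArg Prod.snd h'
    simp only [Prod.snd_zero, mul_eq_zero, OfNat.ofNat_ne_zero, false_or] at this
    exact hN.ne_one (sub_eq_zero.1 this).symm
  have hcases : ∀ σ : K ≃ₐ[ℚ] K, mapPt (σ : K →+* K) P ≠ P →
      c ^ 2 - c + 1 = 0 ∧ mapPt (σ : K →+* K) P = F.onLine (F.onLine P) := by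
    intro σ hσ
    have e := hsecond _ (hconj σ) hσ
    have hσσ := hinvol σ hσ
    rcases hN.parameter_eq_zero hF (hconj σ).crit (hZ ▸ hσ) (hconj σ).four (hconj σ).two with
      h | h | h | h
    · exfalso
      have e' : mapPt (σ : K →+* K) P = F.onLine (F.onLine (F.onLine P)) := by
        rw [e, o3, h, zero_smul, zero_add,
          proj_smul (mul_ne_zero two_ne_zero (sub_ne_zero.2 hN.ne_one.symm))
            (ne_zero_of_det₂_right hN.det_ne)]
      have e2 : F.onLine (F.onLine (F.onLine (mapPt (σ : K →+* K) P))) = P := by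
        rw [hmap, hmap, hmap, ← e', hσσ]
      rw [e', hP.four] at e2
      exact hP.two e2
    · exfalso
      have e' : mapPt (σ : K →+* K) P = F.onLine P := by
        have := (hN.proj_eq_proj_iff hz (w := (c + 1, 1)) (by simp)).2
          (by simp only [det₂]; linear_combination h)
        rw [e, o1, this, one_smul]
      have e2 := hmap σ P
      rw [← e', hσσ, e'] at e2
      exact hP.two e2
    · refine ⟨h, ?_⟩
      have := (hN.proj_eq_proj_iff hz (w := (c, 1)) (by simp)).2
        (by simp only [det₂]; linear_combination h)
      rw [e, o2, this, one_smul]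
    · exact absurd h (secondCritPoly_ne_zero hK c)
  -- An automorphism fixes the cycle pointwise or shifts it by two. The cross-ratio relation for c
  -- is preserved by the exchange of P with F²P and of FP with F³P.
  have hfix : ∀ τ : K ≃ₐ[ℚ] K, τ c = c := by
    intro τ
    have hD : det₂ (lift P) (lift (F.onLine (F.onLine (F.onLine P)))) *
        det₂ (lift (F.onLine (F.onLine P))) (lift (F.onLine P)) ≠ 0 := by
      refine mul_ne_zero (det₂_lift_ne_zero fun h => ?_) (det₂_lift_ne_zero fun h => ?_)
      · have h4 := hP.four
        rw [← h] at h4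
        exact hP.two (by rw [h4, h4])
      · have h4 := hP.four
        rw [h, h, h] at h4
        exact hP.two (by rw [h4, h4])
    have e := congrArg (τ : K →+* K) hcross
    simp only [map_mul, map_neg, ← det₂_map, ← lift_mapPt, ← hmap] at e
    refine mul_right_cancel₀ hD ?_
    by_cases hτ : mapPt (τ : K →+* K) P = P
    · rw [hτ] at e
      exact e.trans hcross.symm
    · rw [(hcases τ hτ).2, hP.four] at e
      change τ c * _ = _ at e
      linear_combination e - hcross
  by_contra hσ
  obtain ⟨q, hq⟩ := IntermediateField.mem_bot.1 ((IsGalois.mem_bot_iff_fixed c).2 hfix)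
  have h0 := (hcases σ hσ).1
  rw [← hq] at h0
  have h1 : q ^ 2 - q + 1 = 0 := by
    apply (algebraMap ℚ K).injective
    simpa using h0
  nlinarith [sq_nonneg (q - 1 / 2)]

end QuadPair

section

open IntermediateField

lemma isCritFour_of_mem {φ : RatFunc ℚ} (hφ : φ ∈ Rat 2 ℚ) {P : OnePoint (AlgebraicClosure ℚ)}
    (hP : P ∈ periodicCriticalPts 4 φ) : (quadPair (AlgebraicClosure ℚ) φ).IsCritFour P := by
  obtain ⟨h1, -, h2⟩ := hP
  rw [minimalPeriod_eq_four_iff, toMap_eq_onLine hφ] at h2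
  exact ⟨h1.isCrit hφ, h2.1, h2.2⟩

/-- The Wronskian of the numerator and the denominator, which vanishes at the finite critical
points. -/
def wronskianPoly {K : Type*} [Field K] (F : QuadPair K) : K[X] :=
  C (F.a * F.e - F.b * F.d) * X ^ 2 + C (2 * (F.a * F.f - F.c * F.d)) * X +
    C (F.b * F.f - F.c * F.e)

/-- A zero Wronskian would make numerator and denominator proportional, against coprimality.
Characteristic 2 has to be excluded: there x² has zero Wronskian. -/
lemma wronskianPoly_ne_zero {K : Type*} [Field K] [CharZero K] {φ : RatFunc K}
    (hφ : φ ∈ Rat 2 K) : wronskianPoly (quadPair K φ) ≠ 0 := by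
  intro h
  have h2 := congrArg (fun p => coeff p 2) h
  have h1 := congrArg (fun p => coeff p 1) h
  simp only [wronskianPoly, coeff_add, coeff_C_mul, coeff_X_pow, coeff_X, coeff_C, coeff_zero,
    quadPair, Algebra.algebraMap_self, RingHom.id_apply] at h1 h2
  norm_num at h1 h2
  have hN := natDegree_num_le hφ
  have hD := natDegree_denom_le hφ
  have key : C (φ.denom.coeff 2) * φ.num = C (φ.num.coeff 2) * φ.denom := by
    ext n
    rw [coeff_C_mul, coeff_C_mul]
    rcases Nat.lt_or_ge 2 n with hn | hn
    · rw [coeff_eq_zero_of_natDegree_lt (hN.trans_lt hn),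
        coeff_eq_zero_of_natDegree_lt (hD.trans_lt hn), mul_zero, mul_zero]
    · interval_cases n
      · linear_combination -h1
      · linear_combination -h2
      · ring
  have hcop := φ.isCoprime_num_denom
  rcases coeff_two_ne_zero hφ with h0 | h0
  · have hdvd : φ.num ∣ C (φ.num.coeff 2) :=
      hcop.dvd_of_dvd_mul_right ⟨C (φ.denom.coeff 2), by rw [← key, mul_comm]⟩
    have := natDegree_le_of_dvd hdvd (C_ne_zero.2 h0)
    rw [natDegree_C] at this
    exact h0 (coeff_eq_zero_of_natDegree_lt (by omega))
  · have hdvd : φ.denom ∣ C (φ.denom.coeff 2) :=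
      hcop.symm.dvd_of_dvd_mul_right ⟨C (φ.num.coeff 2), by rw [key, mul_comm]⟩
    have := natDegree_le_of_dvd hdvd (C_ne_zero.2 h0)
    rw [natDegree_C] at this
    exact h0 (coeff_eq_zero_of_natDegree_lt (by omega))

lemma aeval_wronskianPoly {K L : Type*} [Field K] [Field L] [Algebra K L] {φ : RatFunc K} {x : L}
    (h : (quadPair L φ).IsCrit (x, 1)) : aeval x (wronskianPoly (quadPair K φ)) = 0 := by
  have := h (1, 0)
  simp only [det₂, QuadPair.polar, QuadPair.eval, quadPair] at this
  simp only [wronskianPoly, quadPair, map_add, map_sub, map_mul, map_pow, map_ofNat, aeval_X,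
    aeval_C, Algebra.algebraMap_self, RingHom.id_apply]
  linear_combination this

/-- The `4`-periodic critical points of a quadratic map over `ℚ` are rational. -/
theorem exists_rational_isCritFour {φ : RatFunc ℚ} (hφ : φ ∈ Rat 2 ℚ)
    {P : OnePoint (AlgebraicClosure ℚ)} (hP : (quadPair (AlgebraicClosure ℚ) φ).IsCritFour P) :
    ∃ P₀ : OnePoint ℚ, (quadPair ℚ φ).IsCritFour P₀ := by
  have hmap := quadPair_map (K := ℚ) (algebraMap ℚ (AlgebraicClosure ℚ)) (RingHom.comp_id _) φ
  cases P with
  | infty =>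
    exact ⟨OnePoint.infty, QuadPair.isCritFour_of_map (f := algebraMap ℚ (AlgebraicClosure ℚ))
      (by rwa [hmap])⟩
  | coe θ =>
    suffices h : θ ∈ (⊥ : IntermediateField ℚ (AlgebraicClosure ℚ)) by
      obtain ⟨q, rfl⟩ := mem_bot.1 h
      exact ⟨(q : OnePoint ℚ),
        QuadPair.isCritFour_of_map (f := algebraMap ℚ (AlgebraicClosure ℚ)) (by rwa [hmap])⟩
    have hθ : IsIntegral ℚ θ := (AlgebraicClosure.isAlgebraic ℚ).isAlgebraic θ |>.isIntegral
    have : FiniteDimensional ℚ ℚ⟮θ⟯ := adjoin.finiteDimensional hθ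
    have hK : Module.finrank ℚ ℚ⟮θ⟯ ≤ 2 := by
      rw [adjoin.finrank hθ]
      have h1 := minpoly.degree_le_of_ne_zero ℚ θ (wronskianPoly_ne_zero hφ)
        (aeval_wronskianPoly hP.crit)
      have h2 : (wronskianPoly (quadPair ℚ φ)).degree ≤ 2 := degree_quadratic_le
      exact natDegree_le_of_degree_le (h1.trans h2)
    have hpos : 0 < Module.finrank ℚ ℚ⟮θ⟯ := Module.finrank_pos
    have hcases : Module.finrank ℚ ℚ⟮θ⟯ = 1 ∨ Module.finrank ℚ ℚ⟮θ⟯ = 2 := by omega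
    rcases hcases with h | h
    · rw [← finrank_eq_one_iff.1 h]
      exact mem_adjoin_simple_self ℚ θ
    -- A quadratic extension of ℚ is Galois, so an element fixed by all automorphisms is rational.
    · have : Algebra.IsQuadraticExtension ℚ ℚ⟮θ⟯ := ⟨h⟩
      have hgen : (quadPair ℚ⟮θ⟯ φ).IsCritFour ((AdjoinSimple.gen ℚ θ : ℚ⟮θ⟯) : OnePoint ℚ⟮θ⟯) := by
        refine QuadPair.isCritFour_of_map (f := algebraMap ℚ⟮θ⟯ (AlgebraicClosure ℚ)) ?_
        rw [quadPair_map _ (IsScalarTower.algebraMap_eq ..).symm]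
        exact hP
      have hfix : ∀ σ : ℚ⟮θ⟯ ≃ₐ[ℚ] ℚ⟮θ⟯, σ (AdjoinSimple.gen ℚ θ) = AdjoinSimple.gen ℚ θ := by
        intro σ
        have := hgen.mapPt_eq hK (quadPair_nondeg hφ)
          (fun σ => quadPair_map _ (RingHom.ext fun x => σ.commutes x) φ) σ
        exact OnePoint.coe_injective this
      obtain ⟨q, hq⟩ := mem_bot.1 ((IsGalois.mem_bot_iff_fixed _).2 hfix)
      refine mem_bot.2 ⟨q, ?_⟩
      rw [← AdjoinSimple.algebraMap_gen ℚ θ, ← hq, ← IsScalarTower.algebraMap_apply]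

end

/-! ### Composition, Möbius transformations and conjugacy -/

section Composition

variable {K : Type*} [Field K]

/-- A rational function that is not a constant. -/
def IsNonconst (φ : RatFunc K) : Prop := ¬ ∃ a, φ = RatFunc.C a

/-- A nonconstant rational function is transcendental over K, so no denominator vanishes on
substituting it. Composition on the right is therefore a ring homomorphism. -/
lemma IsNonconst.eval₂_ne_zero {ψ : RatFunc K} (hψ : IsNonconst ψ) {p : K[X]} (hp : p ≠ 0) :
    eval₂ (RatFunc.C : K →+* RatFunc K) ψ p ≠ 0 := by
  intro h
  refine hp ((transcendental_iff.1 (RatFunc.transcendental_of_ne_C ψ hψ)) p ?_)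
  rw [aeval_def, RatFunc.algebraMap_eq_C, h]

/-- Composition with a nonconstant rational function on the right. -/
def compHom (ψ : RatFunc K) (hψ : IsNonconst ψ) : RatFunc K →+* RatFunc K where
  toFun φ := comp φ ψ
  map_one' := RatFunc.eval_one _ _
  map_zero' := RatFunc.eval_zero _ _
  map_add' φ χ := RatFunc.eval_add _ _ (hψ.eval₂_ne_zero φ.denom_ne_zero)
    (hψ.eval₂_ne_zero χ.denom_ne_zero)
  map_mul' φ χ := RatFunc.eval_mul _ _ (hψ.eval₂_ne_zero φ.denom_ne_zero)
    (hψ.eval₂_ne_zero χ.denom_ne_zero)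

lemma compHom_apply {ψ : RatFunc K} (hψ : IsNonconst ψ) (φ : RatFunc K) :
    compHom ψ hψ φ = comp φ ψ := rfl

lemma comp_C (a : K) (ψ : RatFunc K) : comp (RatFunc.C a) ψ = RatFunc.C a := by simp [comp]

lemma X_comp (ψ : RatFunc K) : comp RatFunc.X ψ = ψ := by simp [comp]

/-- Reduces identities between compositions, associativity in particular, to constants and X. -/
lemma ringHom_ext_of_C_X {f g : RatFunc K →+* RatFunc K}
    (hC : ∀ a, f (RatFunc.C a) = g (RatFunc.C a)) (hX : f RatFunc.X = g RatFunc.X) : f = g := by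
  refine IsLocalization.ringHom_ext (nonZeroDivisors K[X]) (Polynomial.ringHom_ext ?_ ?_)
  · intro a
    simpa using hC a
  · simpa using hX

lemma comp_X (φ : RatFunc K) : comp φ RatFunc.X = φ := by
  have hX : IsNonconst (RatFunc.X : RatFunc K) := by
    rintro ⟨a, h⟩
    have := congrArg RatFunc.num h
    rw [RatFunc.num_X, RatFunc.num_C] at this
    simpa using congrArg natDegree this
  exact RingHom.congr_fun (ringHom_ext_of_C_X (f := compHom _ hX) (g := RingHom.id _)
    (fun a => comp_C a _) (X_comp _)) φ

lemma IsNonconst.comp {φ ψ : RatFunc K} (hφ : IsNonconst φ) (hψ : IsNonconst ψ) :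
    IsNonconst (comp φ ψ) := by
  rintro ⟨a, h⟩
  refine hφ ⟨a, (compHom ψ hψ).injective ?_⟩
  rw [compHom_apply, compHom_apply, h, comp_C]

lemma comp_assoc {φ ψ χ : RatFunc K} (hψ : IsNonconst ψ) (hχ : IsNonconst χ) :
    comp (comp φ ψ) χ = comp φ (comp ψ χ) :=
  RingHom.congr_fun (ringHom_ext_of_C_X (f := (compHom χ hχ).comp (compHom ψ hψ))
    (g := compHom _ (hψ.comp hχ))
    (fun a => by simp [compHom_apply, comp_C]) (by simp [compHom_apply, X_comp])) φ

lemma isNonconst_of_degree {φ : RatFunc K} (h : degree φ ≠ 0) : IsNonconst φ := by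
  rintro ⟨a, rfl⟩
  simp [degree] at h

/-- The numerator and denominator of a quotient of coprime polynomials. -/
lemma exists_num_denom_div {p q : K[X]} (hpq : IsCoprime p q) (hq : q ≠ 0) :
    ∃ u : K, u ≠ 0 ∧ (algebraMap K[X] (RatFunc K) p / algebraMap K[X] (RatFunc K) q).num = C u * p ∧
      (algebraMap K[X] (RatFunc K) p / algebraMap K[X] (RatFunc K) q).denom = C u * q := by
  set φ := algebraMap K[X] (RatFunc K) p / algebraMap K[X] (RatFunc K) q with hφ
  have e := (RatFunc.num_mul_eq_mul_denom_iff hq).2 hφ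
  -- Each of q and the reduced denominator divides the other, so they differ by a nonzero constant.
  obtain ⟨r, hr⟩ : q ∣ φ.denom := hpq.symm.dvd_of_dvd_mul_left ⟨φ.num, by rw [← e, mul_comm]⟩
  obtain ⟨s, hs⟩ : φ.denom ∣ q := RatFunc.denom_div_dvd p q
  have hu : IsUnit r := by
    refine IsUnit.of_mul_eq_one s (mul_left_cancel₀ hq ?_)
    rw [← mul_assoc, ← hr, ← hs, mul_one]
  obtain ⟨u, hu0, rfl⟩ := isUnit_iff.1 hu
  refine ⟨u, hu0.ne_zero, mul_right_cancel₀ hq ?_, by rw [hr, mul_comm]⟩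
  rw [e, hr]
  ring

lemma degree_div {p q : K[X]} (hpq : IsCoprime p q) (hq : q ≠ 0) :
    degree (algebraMap K[X] (RatFunc K) p / algebraMap K[X] (RatFunc K) q) =
      max p.natDegree q.natDegree := by
  obtain ⟨u, hu, h1, h2⟩ := exists_num_denom_div hpq hq
  rw [degree, h1, h2, natDegree_C_mul hu, natDegree_C_mul hu]

/-- The Möbius transformation `(a x + b) / (c x + d)`. -/
def mob (a b c d : K) : RatFunc K :=
  (RatFunc.C a * RatFunc.X + RatFunc.C b) / (RatFunc.C c * RatFunc.X + RatFunc.C d)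

lemma linear_ne_zero {f : RatFunc K} (hf : IsNonconst f) {c d : K} (h : c ≠ 0 ∨ d ≠ 0) :
    RatFunc.C c * f + RatFunc.C d ≠ 0 := by
  have hp : (C c * X + C d : K[X]) ≠ 0 := by
    intro h0
    have h1 : c = 0 := by simpa [coeff_C] using congrArg (fun p => coeff p 1) h0
    have h2 : d = 0 := by simpa using congrArg (fun p => coeff p 0) h0
    exact h.elim (· h1) (· h2)
  simpa using hf.eval₂_ne_zero hp

lemma mob_comp {f : RatFunc K} (hf : IsNonconst f) (a b c d : K) :
    comp (mob a b c d) f = (RatFunc.C a * f + RatFunc.C b) / (RatFunc.C c * f + RatFunc.C d) := by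
  rw [← compHom_apply hf, mob]
  simp only [map_div₀, map_add, map_mul, compHom_apply, comp_C, X_comp]

lemma mob_mem_rat {a b c d : K} (h : a * d - b * c ≠ 0) : mob a b c d ∈ Rat 1 K := by
  have hcop : IsCoprime (C a * X + C b : K[X]) (C c * X + C d) := by
    refine ⟨C (-c / (a * d - b * c)), C (a / (a * d - b * c)), ?_⟩
    have : (C (-c / (a * d - b * c)) * (C a * X + C b) +
        C (a / (a * d - b * c)) * (C c * X + C d) : K[X]) =
        C ((a * d - b * c) / (a * d - b * c)) := by
      simp only [div_eq_mul_inv, map_mul, map_sub, map_neg]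
      ring
    rw [this, div_self h, C_1]
  have hq : (C c * X + C d : K[X]) ≠ 0 := by
    intro h0
    have h1 : c = 0 := by simpa [coeff_C] using congrArg (fun p => coeff p 1) h0
    have h2 : d = 0 := by simpa using congrArg (fun p => coeff p 0) h0
    simp [h1, h2] at h
  have e : mob a b c d = algebraMap K[X] (RatFunc K) (C a * X + C b) /
      algebraMap K[X] (RatFunc K) (C c * X + C d) := by
    simp [mob]
  change degree _ = 1
  rw [e, degree_div hcop hq]
  have h1 : (C a * X + C b : K[X]).natDegree ≤ 1 := natDegree_linear_le
  have h2 : (C c * X + C d : K[X]).natDegree ≤ 1 := natDegree_linear_le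
  by_cases ha : a = 0
  · have hc : c ≠ 0 := by rintro rfl; simp [ha] at h
    rw [natDegree_linear hc]
    exact max_eq_right h1
  · rw [natDegree_linear ha]
    exact max_eq_left h2

lemma exists_eq_mob {σ : RatFunc K} (hσ : σ ∈ Rat 1 K) :
    ∃ a b c d : K, a * d - b * c ≠ 0 ∧ σ = mob a b c d := by
  have hdeg : max σ.num.natDegree σ.denom.natDegree = 1 := hσ
  obtain ⟨a, b, hab⟩ := exists_eq_X_add_C_of_natDegree_le_one ((le_max_left _ _).trans_eq hdeg)
  obtain ⟨c, d, hcd⟩ := exists_eq_X_add_C_of_natDegree_le_one ((le_max_right _ _).trans_eq hdeg)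
  refine ⟨a, b, c, d, fun h => ?_, ?_⟩
  · obtain ⟨u, v, huv⟩ := σ.isCoprime_num_denom
    have e : C c * σ.num = C a * σ.denom := by
      rw [hab, hcd, mul_add, mul_add, ← C_mul, ← C_mul, show c * b = a * d by linear_combination -h,
        mul_left_comm]
    -- If the determinant vanished, Bézout would make numerator and denominator divide their own
    -- leading constants a and c, so both would be constant.
    have ha : C a = σ.num * (C a * u + C c * v) := by linear_combination -C a * huv - v * e
    have hc : C c = σ.denom * (C a * u + C c * v) := by linear_combination -C c * huv + u * e
    have hne : a ≠ 0 ∨ c ≠ 0 := by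
      by_contra! h0
      rw [hab, hcd, h0.1, h0.2] at hdeg
      simp at hdeg
    have aux : ∀ {p : K[X]} {a b : K}, p = C a * X + C b → p ∣ C a → a = 0 := by
      intro p a b hp hd
      by_contra ha
      have := natDegree_le_of_dvd hd (C_ne_zero.2 ha)
      rw [hp, natDegree_C, natDegree_linear ha] at this
      omega
    exact hne.elim (· (aux hab ⟨_, ha⟩)) (· (aux hcd ⟨_, hc⟩))
  · conv_lhs => rw [← σ.num_div_denom, hab, hcd]
    simp [mob]

lemma comp_mem_rat_one {σ τ : RatFunc K} (hσ : σ ∈ Rat 1 K) (hτ : τ ∈ Rat 1 K) :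
    comp σ τ ∈ Rat 1 K := by
  have hτ' : IsNonconst τ := isNonconst_of_degree (by rw [show degree τ = 1 from hτ]; norm_num)
  obtain ⟨a, b, c, d, h, rfl⟩ := exists_eq_mob hσ
  obtain ⟨a', b', c', d', h', e⟩ := exists_eq_mob hτ
  have hX : IsNonconst (RatFunc.X : RatFunc K) := by
    apply isNonconst_of_degree
    simp [degree]
  have hD : RatFunc.C c' * RatFunc.X + RatFunc.C d' ≠ 0 := by
    refine linear_ne_zero hX ?_
    by_contra! h0
    simp [h0.1, h0.2] at h'
  have key : comp (mob a b c d) τ =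
      mob (a * a' + b * c') (a * b' + b * d') (c * a' + d * c') (c * b' + d * d') := by
    rw [mob_comp hτ', e, mob, mob]
    rw [← mul_div_mul_right _ _ hD, add_mul, add_mul, mul_assoc, mul_assoc, div_mul_cancel₀ _ hD]
    simp only [map_add, map_mul]
    congr 1 <;> ring
  rw [key]
  apply mob_mem_rat
  have := mul_ne_zero h h'
  contrapose! this
  linear_combination this

lemma LinearlyConjugate.symm {φ ψ : RatFunc K} (hφ : IsNonconst φ) (h : LinearlyConjugate φ ψ) :
    LinearlyConjugate ψ φ := by
  obtain ⟨σ, hσ, τ, hτ, h1, h2, rfl⟩ := h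
  have hσ' : IsNonconst σ := isNonconst_of_degree (by rw [show degree σ = 1 from hσ]; norm_num)
  have hτ' : IsNonconst τ := isNonconst_of_degree (by rw [show degree τ = 1 from hτ]; norm_num)
  refine ⟨τ, hτ, σ, hσ, h2, h1, ?_⟩
  rw [comp_assoc (hφ.comp hσ') hτ', comp_assoc hσ' hτ', h1, comp_X, ← comp_assoc hτ' hφ, h1, X_comp]

lemma LinearlyConjugate.isNonconst {φ ψ : RatFunc K} (hφ : IsNonconst φ)
    (h : LinearlyConjugate φ ψ) : IsNonconst ψ := by
  obtain ⟨σ, hσ, τ, hτ, -, -, rfl⟩ := h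
  have hσ' : IsNonconst σ := isNonconst_of_degree (by rw [show degree σ = 1 from hσ]; norm_num)
  have hτ' : IsNonconst τ := isNonconst_of_degree (by rw [show degree τ = 1 from hτ]; norm_num)
  exact hτ'.comp (hφ.comp hσ')

lemma LinearlyConjugate.trans {φ ψ χ : RatFunc K} (hφ : IsNonconst φ)
    (h : LinearlyConjugate φ ψ) (h' : LinearlyConjugate ψ χ) : LinearlyConjugate φ χ := by
  obtain ⟨σ, hσ, τ, hτ, h1, h2, rfl⟩ := h
  obtain ⟨σ', hσ', τ', hτ', h1', h2', rfl⟩ := h'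
  have nσ : IsNonconst σ := isNonconst_of_degree (by rw [show degree σ = 1 from hσ]; norm_num)
  have nτ : IsNonconst τ := isNonconst_of_degree (by rw [show degree τ = 1 from hτ]; norm_num)
  have nσ' : IsNonconst σ' := isNonconst_of_degree (by rw [show degree σ' = 1 from hσ']; norm_num)
  have nτ' : IsNonconst τ' := isNonconst_of_degree (by rw [show degree τ' = 1 from hτ']; norm_num)
  refine ⟨comp σ σ', comp_mem_rat_one hσ hσ', comp τ' τ, comp_mem_rat_one hτ' hτ, ?_, ?_, ?_⟩
  · rw [comp_assoc nσ' (nτ'.comp nτ), ← comp_assoc nτ' nτ, h1', X_comp, h1]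
  · rw [comp_assoc nτ (nσ.comp nσ'), ← comp_assoc nσ nσ', h2, X_comp, h2']
  · rw [comp_assoc (hφ.comp nσ) nσ', comp_assoc nσ nσ', comp_assoc nτ (hφ.comp (nσ.comp nσ'))]

lemma arithClass_eq_of_linearlyConjugate {φ ψ : RatFunc K} (hφ : IsNonconst φ)
    (h : LinearlyConjugate φ ψ) : arithClass φ = arithClass ψ :=
  Set.ext fun _ => ⟨fun hχ => (h.symm hφ).trans (h.isNonconst hφ) hχ, fun hχ => h.trans hφ hχ⟩

end Composition

/-! ### The family and its 4-periodic critical point -/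

/-- The numerator of `phi c`. -/
def phiNum (c : ℚ) : ℚ[X] := C (c + c ^ 2 - c ^ 3) * X - C (c ^ 2)

/-- The denominator of `phi c`. -/
def phiDenom (c : ℚ) : ℚ[X] :=
  C (c ^ 3 - c ^ 2 - c + 1) * X ^ 2 - C (c ^ 3 - c ^ 2 - c) * X - C (c ^ 2)

lemma phi_eq_div (c : ℚ) : phi c =
    algebraMap ℚ[X] (RatFunc ℚ) (phiNum c) / algebraMap ℚ[X] (RatFunc ℚ) (phiDenom c) := by
  simp [phi, phiNum, phiDenom]

lemma phi_leading_ne_zero {c : ℚ} (hc1 : c ≠ 1) (hc2 : c ≠ -1) :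
    c ^ 3 - c ^ 2 - c + 1 ≠ 0 := by
  rw [show c ^ 3 - c ^ 2 - c + 1 = (c - 1) ^ 2 * (c + 1) by ring]
  exact mul_ne_zero (pow_ne_zero 2 (sub_ne_zero.2 hc1))
    fun h => hc2 (eq_neg_of_add_eq_zero_left h)

/-- The denominator is the numerator plus (c−1)²(c+1)x², and the numerator takes the value −c² ≠ 0
at 0. -/
lemma isCoprime_phiNum_phiDenom {c : ℚ} (hc0 : c ≠ 0) (hc1 : c ≠ 1) (hc2 : c ≠ -1) :
    IsCoprime (phiNum c) (phiDenom c) := by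
  have hA := phi_leading_ne_zero hc1 hc2
  have hX : IsCoprime (phiNum c) X := by
    refine ⟨C (-(c ^ 2)⁻¹), C ((c ^ 2)⁻¹ * (c + c ^ 2 - c ^ 3)), ?_⟩
    have : (C (-(c ^ 2)⁻¹) * phiNum c + C ((c ^ 2)⁻¹ * (c + c ^ 2 - c ^ 3)) * X : ℚ[X]) =
        C ((c ^ 2)⁻¹ * c ^ 2) := by
      simp only [phiNum, map_mul, map_neg]
      ring
    rw [this, inv_mul_cancel₀ (pow_ne_zero 2 hc0), C_1]
  have h2 : IsCoprime (phiNum c) (C (c ^ 3 - c ^ 2 - c + 1) * X ^ 2) :=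
    (isCoprime_mul_unit_left_right (isUnit_C.2 hA.isUnit) _ _).2 hX.pow_right
  have e : phiDenom c = C (c ^ 3 - c ^ 2 - c + 1) * X ^ 2 + phiNum c * 1 := by
    simp only [phiDenom, phiNum, map_add, map_sub]
    ring
  rw [e]
  exact h2.add_mul_left_right 1

lemma natDegree_phiDenom {c : ℚ} (hc1 : c ≠ 1) (hc2 : c ≠ -1) : (phiDenom c).natDegree = 2 := by
  have hA := phi_leading_ne_zero hc1 hc2
  rw [phiDenom, sub_sub]
  have : (C (c ^ 3 - c ^ 2 - c) * X + C (c ^ 2) : ℚ[X]).natDegree ≤ 1 := natDegree_linear_le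
  have h2 : (C (c ^ 3 - c ^ 2 - c + 1) * X ^ 2 : ℚ[X]).natDegree = 2 := natDegree_C_mul_X_pow 2 _ hA
  rw [natDegree_sub_eq_left_of_natDegree_lt (by omega), h2]

lemma phiDenom_ne_zero {c : ℚ} (hc1 : c ≠ 1) (hc2 : c ≠ -1) : phiDenom c ≠ 0 := by
  intro h
  simpa [h] using natDegree_phiDenom hc1 hc2

lemma phi_mem_rat {c : ℚ} (hc0 : c ≠ 0) (hc1 : c ≠ 1) (hc2 : c ≠ -1) : phi c ∈ Rat 2 ℚ := by
  change degree _ = 2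
  rw [phi_eq_div, degree_div (isCoprime_phiNum_phiDenom hc0 hc1 hc2) (phiDenom_ne_zero hc1 hc2),
    natDegree_phiDenom hc1 hc2]
  refine max_eq_right (le_trans ?_ one_le_two)
  rw [phiNum, sub_eq_add_neg, ← C_neg]
  exact natDegree_linear_le

lemma exists_num_denom_phi {c : ℚ} (hc0 : c ≠ 0) (hc1 : c ≠ 1) (hc2 : c ≠ -1) :
    ∃ u : ℚ, u ≠ 0 ∧ (phi c).num = C u * phiNum c ∧ (phi c).denom = C u * phiDenom c := by
  rw [phi_eq_div]
  exact exists_num_denom_div (isCoprime_phiNum_phiDenom hc0 hc1 hc2) (phiDenom_ne_zero hc1 hc2)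

lemma quadPair_phi {c : ℚ} (L : Type*) [Field L] [Algebra ℚ L] {u : ℚ}
    (h1 : (phi c).num = C u * phiNum c) (h2 : (phi c).denom = C u * phiDenom c) :
    quadPair L (phi c) = ⟨0, algebraMap ℚ L (u * (c + c ^ 2 - c ^ 3)), algebraMap ℚ L (u * -c ^ 2),
      algebraMap ℚ L (u * (c ^ 3 - c ^ 2 - c + 1)), algebraMap ℚ L (u * (c + c ^ 2 - c ^ 3)),
      algebraMap ℚ L (u * -c ^ 2)⟩ := by
  simp only [quadPair, h1, h2, phiNum, phiDenom, coeff_C_mul, coeff_sub, coeff_X_pow, coeff_X,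
    coeff_C]
  norm_num
  ring_nf

/-- The map `phi c` is conjugate to the normal form with parameter `c`. -/
lemma isNormalForm_phi {c : ℚ} (hc0 : c ≠ 0) (hc1 : c ≠ 1) (hc2 : c ≠ -1) (L : Type*) [Field L]
    [Algebra ℚ L] [CharZero L] : ∃ ρ : L,
      (quadPair L (phi c)).IsNormalForm (0, algebraMap ℚ L (c - 1))
        (algebraMap ℚ L c, algebraMap ℚ L (1 + c - c ^ 2)) (algebraMap ℚ L c) ρ := by
  obtain ⟨u, hu, h1, h2⟩ := exists_num_denom_phi hc0 hc1 hc2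
  have hi : ∀ q : ℚ, algebraMap ℚ L q = 0 ↔ q = 0 := fun q => map_eq_zero _
  -- The basis vectors lie over 0 and c/(1+c−c²), scaled so that (c+1)Z + W = (c, c) and cZ + W =
  -- (c, 1) lie over 1 and c. The scale is read off from F(Z) = ρ(c−1)((c+1)Z + W).
  refine ⟨algebraMap ℚ L (-u * c * (c - 1)), ?_, ?_, ?_, ?_, ?_, ?_⟩
  · simp only [det₂]
    rw [← map_mul, zero_mul, zero_sub, neg_ne_zero, Ne, hi]
    exact mul_ne_zero (sub_ne_zero.2 hc1) hc0
  · rw [Ne, hi]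
    exact mul_ne_zero (mul_ne_zero (neg_ne_zero.2 hu) hc0) (sub_ne_zero.2 hc1)
  · rwa [Ne, hi]
  · rw [Ne, ← sub_eq_zero, ← map_one (algebraMap ℚ L), ← map_sub, hi, sub_eq_zero]
    exact hc1
  · rw [Ne, ← add_eq_zero_iff_eq_neg, ← map_one (algebraMap ℚ L), ← map_add, hi,
      add_eq_zero_iff_eq_neg]
    exact hc2
  · intro x y
    rw [quadPair_phi L h1 h2]
    simp only [map_mul, map_add, map_sub, map_neg, map_pow, map_one]
    ext <;> simp only [QuadPair.eval, normalMap, Prod.fst_add, Prod.snd_add, Prod.smul_fst,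
      Prod.smul_snd, smul_eq_mul] <;> ring

lemma proj_phi_basis {c : ℚ} (hc1 : c ≠ 1) (L : Type*) [Field L] [Algebra ℚ L] [CharZero L] :
    proj ((0, algebraMap ℚ L (c - 1)) : L × L) = ((0 : L) : OnePoint L) := by
  have : algebraMap ℚ L (c - 1) ≠ 0 := by
    rw [Ne, map_eq_zero]
    exact sub_ne_zero.2 hc1
  simp only [proj, if_neg this, zero_div]

lemma QuadPair.IsNormalForm.period {L : Type*} [Field L] {F : QuadPair L} {Z W : L × L} {c ρ : L}
    (h : F.IsNormalForm Z W c ρ) (hF : F.Nondeg) :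
    F.onLine (F.onLine (F.onLine (F.onLine (proj Z)))) = proj Z ∧
      F.onLine (F.onLine (proj Z)) ≠ proj Z := by
  obtain ⟨-, o2, o3⟩ := h.orbit hF
  obtain ⟨-, e4⟩ := h.onLine_eq hF (z := (0, 1)) (z' := (1, 0)) (k := -c * (c + 1)) (by simp)
    (by ext <;> simp only [normalMap, Prod.smul_mk, smul_eq_mul] <;> ring)
  simp only [one_smul, zero_smul, add_zero, zero_add] at e4
  refine ⟨by rw [o3, e4], ?_⟩
  have h' := (h.proj_eq_proj_iff (z := (c, 1)) (w := (1, 0)) (by simp) (by simp)).not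
  simp only [one_smul, zero_smul, add_zero] at h'
  rw [o2]
  exact h'.2 (by simp [det₂])

lemma isCriticalPt_phi_zero {c : ℚ} (hc0 : c ≠ 0) (hc1 : c ≠ 1) (hc2 : c ≠ -1) (L : Type*) [Field L]
    [Algebra ℚ L] [CharZero L] : IsCriticalPt (phi c) ((0 : L) : OnePoint L) := by
  obtain ⟨u, hu, h1, h2⟩ := exists_num_denom_phi hc0 hc1 hc2
  have hA := phi_leading_ne_zero hc1 hc2
  have hv1 : aeval (0 : L) (phi c).num = algebraMap ℚ L (u * -c ^ 2) := by
    rw [h1]; simp [phiNum]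
  have hv2 : aeval (0 : L) (phi c).denom = algebraMap ℚ L (u * -c ^ 2) := by
    rw [h2]; simp [phiDenom]
  have hne : algebraMap ℚ L (u * -c ^ 2) ≠ 0 := by
    rw [Ne, map_eq_zero]
    exact mul_ne_zero hu (neg_ne_zero.2 (pow_ne_zero 2 hc0))
  change 1 < (fibrePoly (phi c) (toMap L (phi c) ((0 : L) : OnePoint L))).rootMultiplicity 0
  rw [toMap_coe, hv1, hv2, if_neg hne, div_self hne]
  -- Numerator minus denominator is a multiple of x², so the fibre over the value 1 is 0 counted
  -- twice.
  have e : fibrePoly (phi c) ((1 : L) : OnePoint L) =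
      C (algebraMap ℚ L (-(u * (c ^ 3 - c ^ 2 - c + 1)))) * X ^ 2 := by
    change (phi c).num.map (algebraMap ℚ L) - C 1 * (phi c).denom.map (algebraMap ℚ L) = _
    rw [C_1, one_mul, ← Polynomial.map_sub, h1, h2, ← map_C, ← map_X (algebraMap ℚ L),
      ← Polynomial.map_pow, ← Polynomial.map_mul]
    congr 1
    simp only [phiNum, phiDenom, map_add, map_sub, map_neg, map_mul]
    ring
  have hk : algebraMap ℚ L (-(u * (c ^ 3 - c ^ 2 - c + 1))) ≠ 0 := by
    rw [Ne, map_eq_zero]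
    exact neg_ne_zero.2 (mul_ne_zero hu hA)
  rw [e]
  rw [one_lt_rootMultiplicity_iff_isRoot (mul_ne_zero (C_ne_zero.2 hk) (pow_ne_zero 2 X_ne_zero))]
  constructor <;> simp [IsRoot]

lemma rat_sq_ne_five (q : ℚ) : q ^ 2 ≠ 5 := by
  intro h
  have : IsSquare (5 : ℚ) := ⟨q, by rw [← h, sq]⟩
  rw [show (5 : ℚ) = ((5 : ℕ) : ℚ) by norm_num, Rat.isSquare_natCast_iff] at this
  obtain ⟨k, hk⟩ := this
  have : k ≤ 2 := by nlinarith
  interval_cases k <;> omega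

/-- The only `4`-periodic critical point of `phi c` is `0`. -/
theorem periodicCriticalPts_phi {c : ℚ} (hc0 : c ≠ 0) (hc1 : c ≠ 1) (hc2 : c ≠ -1) :
    periodicCriticalPts 4 (phi c) =
      {((0 : AlgebraicClosure ℚ) : OnePoint (AlgebraicClosure ℚ))} := by
  have hφ := phi_mem_rat hc0 hc1 hc2
  obtain ⟨ρ, hN⟩ := isNormalForm_phi hc0 hc1 hc2 (AlgebraicClosure ℚ)
  have hF := quadPair_nondeg (L := AlgebraicClosure ℚ) hφ
  have h0 := proj_phi_basis hc1 (AlgebraicClosure ℚ)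
  ext P
  rw [Set.mem_singleton_iff]
  constructor
  · intro hP
    by_contra hne
    rw [← h0] at hne
    have h := isCritFour_of_mem hφ hP
    have hpar := hN.parameter_eq_zero hF h.crit hne h.four h.two
    have hi : ∀ q : ℚ, algebraMap ℚ (AlgebraicClosure ℚ) q = 0 ↔ q = 0 := fun q => map_eq_zero _
    rw [← map_secondCritPoly] at hpar
    simp only [← map_one (algebraMap ℚ (AlgebraicClosure ℚ)), ← map_pow, ← map_add, ← map_sub,
      hi] at hpar
    -- The three quadratics have discriminants 5, 5 and −3, none of them a square in ℚ.
    rcases hpar with h | h | h | h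
    · exact rat_sq_ne_five (2 * c - 1) (by linear_combination -4 * h)
    · exact rat_sq_ne_five (2 * c + 1) (by linear_combination 4 * h)
    · nlinarith [sq_nonneg (c - 1 / 2)]
    · exact secondCritPoly_ne_zero (K := ℚ) (by simp) c h
  · rintro rfl
    refine ⟨isCriticalPt_phi_zero hc0 hc1 hc2 _, by norm_num, ?_⟩
    rw [minimalPeriod_eq_four_iff, toMap_eq_onLine hφ, ← h0]
    exact hN.period hF

/-! ### Conjugating a rational normal form to the family -/

namespace QuadPair

/-- Normal forms are preserved by extension of scalars. -/
lemma IsNormalForm.map {L L' : Type*} [Field L] [Field L'] {F : QuadPair L} {Z W : L × L} {c ρ : L}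
    (h : F.IsNormalForm Z W c ρ) (f : L →+* L') :
    (F.map f).IsNormalForm (f Z.1, f Z.2) (f W.1, f W.2) (f c) (f ρ) := by
  refine ⟨?_, ?_, ?_, ?_, ?_, ?_⟩
  · rw [det₂_map, Ne, map_eq_zero]
    exact h.det_ne
  · rw [Ne, map_eq_zero]
    exact h.scale_ne
  · rw [Ne, map_eq_zero]
    exact h.ne_zero
  · rw [Ne, ← map_one f, f.injective.eq_iff]
    exact h.ne_one
  · rw [Ne, ← map_one f, ← map_neg, f.injective.eq_iff]
    exact h.ne_neg_one
  -- The normal-form identity is only known for scalars in L. Its values at (1,0), (0,1) and (1,1)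
  -- determine F(Z), F(W) and the polar form, hence the identity over L'.
  · have h10 := h.eval_eq 1 0
    have h01 := h.eval_eq 0 1
    have h11 := h.eval_eq 1 1
    rw [eval_combination] at h11
    simp only [one_smul, zero_smul, add_zero, zero_add] at h10 h01
    intro x y
    have hB : F.polar Z W = (ρ * (1 + c - c ^ 2) * (c + 1)) • Z + (ρ * (1 + c - c ^ 2)) • W := by
      have : F.polar Z W = ((1 : L) ^ 2 • F.eval Z + (1 * 1 : L) • F.polar Z W + (1 : L) ^ 2 • F.eval W) -
          F.eval Z - F.eval W := by module
      rw [this, h11, h10, h01]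
      simp only [normalMap]
      module
    rw [eval_combination, eval_map, eval_map, polar_map, hB, h10, h01]
    ext <;> simp [normalMap] <;> ring

end QuadPair

lemma quadPair_map_C {K : Type*} [Field K] (φ : RatFunc K) :
    (quadPair K φ).map (RatFunc.C : K →+* RatFunc K) = quadPair (RatFunc K) φ :=
  quadPair_map _ (by rw [← RatFunc.algebraMap_eq_C]; exact RingHom.comp_id _) φ

lemma comp_eq_eval_div {K : Type*} [Field K] {φ : RatFunc K} (hφ : φ ∈ Rat 2 K)
    (z : RatFunc K × RatFunc K) (hz : z.2 ≠ 0) :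
    comp φ (z.1 / z.2) =
      ((quadPair (RatFunc K) φ).eval z).1 / ((quadPair (RatFunc K) φ).eval z).2 := by
  have h : ∀ p : K[X], eval₂ (RatFunc.C : K →+* RatFunc K) (z.1 / z.2) p = aeval (z.1 / z.2) p :=
    fun p => by rw [aeval_def, RatFunc.algebraMap_eq_C]
  have h2 : z.2 ^ 2 ≠ 0 := pow_ne_zero 2 hz
  rw [comp, RatFunc.eval, h, h, aeval_of_natDegree_le_two (natDegree_num_le hφ),
    aeval_of_natDegree_le_two (natDegree_denom_le hφ), ← mul_div_mul_right _ _ h2]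
  simp only [QuadPair.eval, quadPair]
  congr 1 <;> field_simp

/-- A quadratic map in normal form with respect to a rational basis is conjugate to `phi c`. -/
theorem linearlyConjugate_phi {φ : RatFunc ℚ} (hφ : φ ∈ Rat 2 ℚ) {Z W : ℚ × ℚ} {c ρ : ℚ}
    (h : (quadPair ℚ φ).IsNormalForm Z W c ρ) : LinearlyConjugate φ (phi c) := by
  have hc0 := h.ne_zero
  have hc1 := h.ne_one
  have hc2 := h.ne_neg_one
  have nψ : IsNonconst (phi c) :=
    isNonconst_of_degree (by rw [show degree (phi c) = 2 from phi_mem_rat hc0 hc1 hc2]; norm_num)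
  have nX : IsNonconst (RatFunc.X : RatFunc ℚ) := by
    apply isNonconst_of_degree
    simp [degree]
  -- The matrix with rows (α, β) and (γ, δ) sends the basis (0, c−1), (c, 1+c−c²) attached to `phi
  -- c` to c(1−c)Z, c(1−c)W.
  obtain ⟨α, hα⟩ : ∃ α, α = (1 + c - c ^ 2) * Z.1 + (1 - c) * W.1 := ⟨_, rfl⟩
  obtain ⟨β, hβ⟩ : ∃ β, β = -c * Z.1 := ⟨_, rfl⟩
  obtain ⟨γ, hγ⟩ : ∃ γ, γ = (1 + c - c ^ 2) * Z.2 + (1 - c) * W.2 := ⟨_, rfl⟩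
  obtain ⟨δ, hδ⟩ : ∃ δ, δ = -c * Z.2 := ⟨_, rfl⟩
  have hdet : α * δ - β * γ ≠ 0 := by
    have : α * δ - β * γ = c * (1 - c) * det₂ Z W := by
      rw [hα, hβ, hγ, hδ, det₂]; ring
    rw [this]
    exact mul_ne_zero (mul_ne_zero hc0 (sub_ne_zero.2 hc1.symm)) h.det_ne
  have hdet' : δ * α - -β * -γ ≠ 0 := by
    contrapose! hdet
    linear_combination hdet
  have mσ := mob_mem_rat hdet
  have mτ := mob_mem_rat hdet'
  have nσ : IsNonconst (mob α β γ δ) :=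
    isNonconst_of_degree (by rw [show degree (mob α β γ δ) = 1 from mσ]; norm_num)
  have nτ : IsNonconst (mob δ (-β) (-γ) α) :=
    isNonconst_of_degree (by rw [show degree (mob δ (-β) (-γ) α) = 1 from mτ]; norm_num)
  have hγδ : γ ≠ 0 ∨ δ ≠ 0 := by
    by_contra! h0
    simp [h0.1, h0.2] at hdet
  have hγα : -γ ≠ 0 ∨ α ≠ 0 := by
    by_contra! h0
    simp [neg_eq_zero.1 h0.1, h0.2] at hdet
  have hdC : RatFunc.C (α * δ - β * γ) ≠ 0 := by
    rw [Ne, map_eq_zero]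
    exact hdet
  have hinv1 : comp (mob α β γ δ) (mob δ (-β) (-γ) α) = RatFunc.X := by
    have hD := linear_ne_zero nX hγα
    rw [mob_comp nτ, ← mul_div_mul_right _ _ hD, add_mul, add_mul, mul_assoc, mul_assoc, mob,
      div_mul_cancel₀ _ hD, div_eq_iff]
    · simp only [map_neg]
      ring
    · convert hdC using 1
      simp only [map_neg, map_sub, map_mul]
      ring
  have hinv2 : comp (mob δ (-β) (-γ) α) (mob α β γ δ) = RatFunc.X := by
    have hD := linear_ne_zero nX hγδ
    rw [mob_comp nσ, ← mul_div_mul_right _ _ hD, add_mul, add_mul, mul_assoc, mul_assoc, mob,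
      div_mul_cancel₀ _ hD, div_eq_iff]
    · simp only [map_neg]
      ring
    · convert hdC using 1
      simp only [map_neg, map_sub, map_mul]
      ring
  -- The normal-form identity is extended to ℚ(x) and evaluated at the generic point σ(x, 1) =
  -- ((1+c−c²)x − c)Z + (1−c)x W.
  have key : comp φ (mob α β γ δ) = comp (mob α β γ δ) (phi c) := by
    have hN := h.map (RatFunc.C : ℚ →+* RatFunc ℚ)
    rw [quadPair_map_C] at hN
    have hev := hN.eval_eq (RatFunc.C (1 + c - c ^ 2) * RatFunc.X - RatFunc.C c)
      (RatFunc.C (1 - c) * RatFunc.X)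
    set N : RatFunc ℚ := RatFunc.C (c + c ^ 2 - c ^ 3) * RatFunc.X - RatFunc.C (c ^ 2) with hNdef
    set D : RatFunc ℚ := RatFunc.C (c ^ 3 - c ^ 2 - c + 1) * RatFunc.X ^ 2
      - RatFunc.C (c ^ 3 - c ^ 2 - c) * RatFunc.X - RatFunc.C (c ^ 2) with hDdef
    have hD0 : D ≠ 0 := by
      have : D = algebraMap ℚ[X] (RatFunc ℚ) (phiDenom c) := by simp [hDdef, phiDenom]
      rw [this]
      exact RatFunc.algebraMap_ne_zero (phiDenom_ne_zero hc1 hc2)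
    have hψ : phi c = N / D := rfl
    have hρ : RatFunc.C ρ ≠ 0 := by
      rw [Ne, map_eq_zero]
      exact h.scale_ne
    rw [mob_comp nψ, hψ, ← mul_div_mul_right _ _ (mul_ne_zero hD0 hρ), mob]
    have hE := comp_eq_eval_div hφ (RatFunc.C α * RatFunc.X + RatFunc.C β,
      RatFunc.C γ * RatFunc.X + RatFunc.C δ) (linear_ne_zero nX hγδ)
    refine hE.trans ?_
    have hz : ((RatFunc.C α * RatFunc.X + RatFunc.C β,
        RatFunc.C γ * RatFunc.X + RatFunc.C δ) : RatFunc ℚ × RatFunc ℚ) =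
        (RatFunc.C (1 + c - c ^ 2) * RatFunc.X - RatFunc.C c) • (RatFunc.C Z.1, RatFunc.C Z.2) +
          (RatFunc.C (1 - c) * RatFunc.X) • (RatFunc.C W.1, RatFunc.C W.2) := by
      ext <;> simp [hα, hβ, hγ, hδ] <;> ring
    rw [hz, hev]
    have e1 : (RatFunc.C α * (N / D) + RatFunc.C β) * (D * RatFunc.C ρ) =
        RatFunc.C ρ * (RatFunc.C α * N + RatFunc.C β * D) := by field_simp
    have e2 : (RatFunc.C γ * (N / D) + RatFunc.C δ) * (D * RatFunc.C ρ) =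
        RatFunc.C ρ * (RatFunc.C γ * N + RatFunc.C δ * D) := by field_simp
    rw [e1, e2]
    congr 1 <;>
    · simp only [normalMap, hNdef, hDdef, hα, hβ, hγ, hδ, Prod.smul_fst, Prod.smul_snd, Prod.fst_add,
        Prod.snd_add, smul_eq_mul, map_add, map_sub, map_mul, map_pow, map_one, map_neg]
      ring
  exact ⟨_, mσ, _, mτ, hinv1, hinv2, by rw [key, ← comp_assoc nσ nψ, hinv2, X_comp]⟩

end RatDyn

end

theorem proposition2p7 :
    RatDyn.arithC 4 =
        {S : Set (RatFunc ℚ) | ∃ c : ℚ, c ∉ ({0, 1, -1} : Set ℚ) ∧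
          S = RatDyn.arithClass (RatDyn.phi c)} ∧
      ∀ c : ℚ, c ∉ ({0, 1, -1} : Set ℚ) →
        RatDyn.periodicCriticalPts 4 (RatDyn.phi c) =
          {((0 : AlgebraicClosure ℚ) : OnePoint (AlgebraicClosure ℚ))} := by
  have hper : ∀ c : ℚ, c ∉ ({0, 1, -1} : Set ℚ) → RatDyn.periodicCriticalPts 4 (RatDyn.phi c) =
      {((0 : AlgebraicClosure ℚ) : OnePoint (AlgebraicClosure ℚ))} := by
    intro c hc
    simp only [Set.mem_insert_iff, Set.mem_singleton_iff, not_or] at hc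
    exact RatDyn.periodicCriticalPts_phi hc.1 hc.2.1 hc.2.2
  refine ⟨Set.ext fun S => ⟨?_, ?_⟩, hper⟩
  · rintro ⟨φ, hφ, ⟨P, hP⟩, rfl⟩
    -- A rational critical cycle allows the normal form to be taken over ℚ itself, so both c and the
    -- conjugation are rational.
    obtain ⟨P₀, h₀⟩ := RatDyn.exists_rational_isCritFour hφ (RatDyn.isCritFour_of_mem hφ hP)
    obtain ⟨Z, W, c, ρ, hN, -, -⟩ :=
      RatDyn.QuadPair.exists_isNormalForm (RatDyn.quadPair_nondeg hφ) h₀.crit h₀.four h₀.two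
    refine ⟨c, ?_, RatDyn.arithClass_eq_of_linearlyConjugate
      (RatDyn.isNonconst_of_degree (by rw [show RatDyn.degree φ = 2 from hφ]; norm_num))
      (RatDyn.linearlyConjugate_phi hφ hN)⟩
    simp only [Set.mem_insert_iff, Set.mem_singleton_iff, not_or]
    exact ⟨hN.ne_zero, hN.ne_one, hN.ne_neg_one⟩
  · rintro ⟨c, hc, rfl⟩
    have hne : (RatDyn.periodicCriticalPts 4 (RatDyn.phi c)).Nonempty := by
      rw [hper c hc]
      exact Set.singleton_nonempty _
    simp only [Set.mem_insert_iff, Set.mem_singleton_iff, not_or] at hc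
    exact ⟨RatDyn.phi c, RatDyn.phi_mem_rat hc.1 hc.2.1 hc.2.2, hne, rfl⟩
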